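/- Let $\Bbbk$ be an algebraically closed field of characteristic $0$, let $\mathcal S=\Bbbk[X_0,\dots,X_n]$ and $\mathcal R=\Bbbk[Y_0,\dots,Y_n]$, and let $\mathcal R$ act on $\mathcal S$ by differentiation, $Y^\beta\circ X^\alpha=\frac{\alpha!}{(\alpha-\beta)!}X^{\alpha-\beta}$ if $\beta\le\alpha$ and $0$ otherwise. View $\mathcal R$ as the coordinate ring of $\mathbb P^n=\mathbb P(\mathcal S_1)$. For $0\neq L\in\mathcal S_1$ let $\wp_L\subset\mathcal R$ be the homogeneous ideal of the point $[L]$; the $j$-fat point at $[L]$ is the scheme defined by $\wp_L^j$. For a $0$-dimensional (possibly empty) closed subscheme $Z\subset\mathbb P^n$ let $I(Z)\subseteq\mathcal R$ be its saturated homogeneous ideal. $Z$ is *apolar* to $F\in\mathcal S_d$ if $G\circ F=0$ for all $G\in I(Z)$; it is *irredundant* to $F$ if it is apolar to $F$ and no strict closed subscheme of $Z$ is apolar to $F$. *Natural apolar scheme.* Let $F\in\mathcal S_d$ and $0\ne L\in\mathcal S_1$. Complete $L$ to a basis $L_0=L,L_1,\dots,L_n$ of $\mathcal S_1$, with dual basis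 $M_0,\dots,M_n$ of $\mathcal R_1$, write $F=\sum_{|\alpha|=d}c_\alpha L_0^{\alpha_0}\cdots L_n^{\alpha_n}$ and put $f_L=\sum_\alpha \alpha!\,c_\alpha\, x_1^{[\alpha_1]}\cdots x_n^{[\alpha_n]}$. Let $\Bbbk[y_1,\dots,y_n]$ act on divided powers by contraction, $y^\beta x^{[\alpha]}=x^{[\alpha-\beta]}$ if $\beta\le\alpha$ and $0$ otherwise, and let $J$ be the annihilator of $f_L$. Then $Z_{F,L}\subset\mathbb P^n$ is the scheme whose ideal $I(Z_{F,L})$ is obtained from the homogenization of $J$ with respect to $Y_0$ by the substitution $Y_i\mapsto M_i$; it does not depend on the choice of the basis. *GAD.* A generalized additive decomposition (GAD) of $F\in\mathcal S_d$ is an expression $F=\sum_{i=1}^sL_i^{d-k_i}G_i$ with $s\ge0$, pairwise non-proportional nonzero $L_i\in\mathcal S_1$, $0\le k_i\le d$, and $G_i\in\mathcal S_{k_i}$ not divisible by $L_i$. It *evinces* the scheme $Z=\bigcup_iZ_{L_i^{d-k_i}G_i,\,L_i}$, that is, $I(Z)=\bigcap_iI(Z_{L_i^{d-k_i}G_i,\,L_i})$.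 **Proposition.** Let $Z\subset\mathbb P^n$ be a $0$-dimensional scheme apolar and irredundant to $F\in\mathcal S_d$. The following are equivalent: 1. $Z$ is evinced by a GAD of $F$; 2. there are $s\ge0$ and nonzero $L_1,\dots,L_s\in\mathcal S_1$ such that $I(Z)\supseteq\bigcap_{i=1}^s\wp_{L_i}^{d+1}$; 3. every connected component of $Z$ is contained in a $(d+1)$-fat point; that is, for every minimal prime $P$ of $I(Z)$ there is a nonzero $L\in\mathcal S_1$ such that the $P$-primary component of $I(Z)$ contains $\wp_L^{d+1}$. (An empty intersection is $\mathcal R$, so that $F=0$ with $Z=\emptyset$ is included.) -/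

import Mathlib

open MvPolynomial

noncomputable section

namespace Apolarity

/-! ### Apolarity action, divided powers, contraction

Forms of `S = k[X_0, …, X_n]` and differential operators of `R = k[Y_0, …, Y_n]` are both elements of
`MvPolynomial (Fin (n + 1)) k`; the binders say which role is meant. -/

/-- The apolarity action (differentiation): the bilinear extension of
`Y^β ∘ X^α = α! / (α - β)! X^(α - β)` if `β ≤ α`, and `0` otherwise. -/
def diffAct {k : Type*} [Field k] {m : ℕ} (G F : MvPolynomial (Fin m) k) : MvPolynomial (Fin m) k :=
  ∑ β ∈ G.support, ∑ α ∈ F.support,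
    if β ≤ α then
      monomial (α - β) (coeff β G * coeff α F * ((∏ i, (α i).descFactorial (β i) : ℕ) : k))
    else 0

/-- The contraction action of `R` on divided powers. An element of the divided power ring is
encoded by its coefficients in the divided power basis: `monomial α c` stands for `c X^[α]`. With
this encoding `Y^β` sends `X^[α]` to `X^[α - β]` if `β ≤ α` and to `0` otherwise. -/
def contract {k : Type*} [Field k] {m : ℕ} (g f : MvPolynomial (Fin m) k) :
    MvPolynomial (Fin m) k :=
  ∑ β ∈ g.support, coeff β g • f.divMonomial β

/-- `F_dp`: the polynomial `F` written in the divided power basis `X^[α] = X^α / α!`. -/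
def toDP {k : Type*} [Field k] {m : ℕ} (F : MvPolynomial (Fin m) k) : MvPolynomial (Fin m) k :=
  ∑ α ∈ F.support, monomial α (((∏ i, (α i).factorial : ℕ) : k) * coeff α F)

theorem coeff_contract {k : Type*} [Field k] {m : ℕ} (g f : MvPolynomial (Fin m) k)
    (γ : Fin m →₀ ℕ) :
    coeff γ (contract g f) = ∑ β ∈ g.support, coeff β g * coeff (β + γ) f := by
  simp [contract, coeff_sum, coeff_divMonomial]

theorem contract_eq_sum {k : Type*} [Field k] {m : ℕ} (g f : MvPolynomial (Fin m) k)
    (s : Finset (Fin m →₀ ℕ)) (hs : g.support ⊆ s) :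
    contract g f = ∑ β ∈ s, coeff β g • f.divMonomial β := by
  unfold contract
  refine Finset.sum_subset hs fun β _ hβ => ?_
  rw [notMem_support_iff.1 hβ, zero_smul]

theorem contract_add_left {k : Type*} [Field k] {m : ℕ} (g h f : MvPolynomial (Fin m) k) :
    contract (g + h) f = contract g f + contract h f := by
  classical
  rw [contract_eq_sum (g + h) f (g.support ∪ h.support) support_add,
    contract_eq_sum g f (g.support ∪ h.support) Finset.subset_union_left,
    contract_eq_sum h f (g.support ∪ h.support) Finset.subset_union_right,
    ← Finset.sum_add_distrib]
  exact Finset.sum_congr rfl fun β _ => by rw [coeff_add, add_smul]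

theorem contract_zero_left {k : Type*} [Field k] {m : ℕ} (f : MvPolynomial (Fin m) k) :
    contract 0 f = 0 := by
  simp [contract]

theorem contract_zero_right {k : Type*} [Field k] {m : ℕ} (g : MvPolynomial (Fin m) k) :
    contract g 0 = 0 := by
  simp [contract]

theorem contract_monomial_left {k : Type*} [Field k] {m : ℕ} (β : Fin m →₀ ℕ) (c : k)
    (f : MvPolynomial (Fin m) k) : contract (monomial β c) f = c • f.divMonomial β := by
  classical
  rw [contract_eq_sum _ _ {β} support_monomial_subset]
  simp

theorem monomial_mul_contract {k : Type*} [Field k] {m : ℕ} (β : Fin m →₀ ℕ) (c : k)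
    (g f : MvPolynomial (Fin m) k) :
    contract (monomial β c * g) f = contract (monomial β c) (contract g f) := by
  induction g using MvPolynomial.induction_on' with
  | monomial γ b =>
    rw [monomial_mul, contract_monomial_left, contract_monomial_left, contract_monomial_left,
      add_comm β γ, divMonomial_add]
    ext δ
    simp [coeff_divMonomial, mul_assoc]
  | add p q hp hq =>
    rw [mul_add, contract_add_left, hp, hq, contract_add_left, contract_monomial_left,
      contract_monomial_left, contract_monomial_left, add_divMonomial, smul_add]

theorem mul_contract {k : Type*} [Field k] {m : ℕ} (h g f : MvPolynomial (Fin m) k) :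
    contract (h * g) f = contract h (contract g f) := by
  induction h using MvPolynomial.induction_on' with
  | monomial β c => exact monomial_mul_contract β c g f
  | add p q hp hq => rw [add_mul, contract_add_left, hp, hq, contract_add_left]

/-- The annihilator of `f` for the contraction action. -/
def contractAnn {k : Type*} [Field k] {m : ℕ} (f : MvPolynomial (Fin m) k) :
    Ideal (MvPolynomial (Fin m) k) where
  carrier := {g | contract g f = 0}
  zero_mem' := contract_zero_left f
  add_mem' := fun {a b} ha hb => by
    rw [Set.mem_ofPred_eq] at ha hb ⊢
    rw [contract_add_left, ha, hb, add_zero]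
  smul_mem' := fun c a ha => by
    rw [Set.mem_ofPred_eq] at ha ⊢
    rw [smul_eq_mul, mul_contract, ha, contract_zero_right]

/-! ### Zero-dimensional subschemes of projective space -/

attribute [local instance] MvPolynomial.gradedAlgebra

/-- A closed subscheme of `ℙ^n` of dimension at most `0` (the empty scheme is included), given by
its saturated homogeneous ideal `I(Z)` in the coordinate ring `R = k[Y_0, …, Y_n]`. -/
structure ZeroDimScheme (k : Type*) [Field k] (n : ℕ) where
  /-- The ideal `I(Z)`. -/
  ideal : Ideal (MvPolynomial (Fin (n + 1)) k)
  homogeneous : ideal.IsHomogeneous (homogeneousSubmodule (Fin (n + 1)) k)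
  /-- Saturation: `(I(Z) : (Y_0, …, Y_n)) = I(Z)`. -/
  saturated : ∀ G : MvPolynomial (Fin (n + 1)) k, (∀ i, X i * G ∈ ideal) → G ∈ ideal
  /-- The affine cone has dimension at most `1`. -/
  dim_le : ringKrullDim (MvPolynomial (Fin (n + 1)) k ⧸ ideal) ≤ 1

/-- `Z` is apolar to `F`: `I(Z) ⊆ Ann(F)`, where `Ann(F) = {G | G ∘ F = 0}`. -/
def IsApolar {k : Type*} [Field k] {n : ℕ} (Z : ZeroDimScheme k n)
    (F : MvPolynomial (Fin (n + 1)) k) : Prop :=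
  ∀ G ∈ Z.ideal, diffAct G F = 0

/-- `Z' ⊆ Z` as closed subschemes of `ℙ^n`. -/
def IsSubscheme {k : Type*} [Field k] {n : ℕ} (Z' Z : ZeroDimScheme k n) : Prop :=
  Z.ideal ≤ Z'.ideal

/-- `Z` is apolar to `F`, and no strict subscheme of `Z` is apolar to `F`. -/
def IsIrredundant {k : Type*} [Field k] {n : ℕ} (Z : ZeroDimScheme k n)
    (F : MvPolynomial (Fin (n + 1)) k) : Prop :=
  IsApolar Z F ∧ ∀ Z' : ZeroDimScheme k n, IsSubscheme Z' Z → IsApolar Z' F → Z' = Z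

/-- The ideal of the connected component of `Z` at the point given by the minimal prime `P` of
`I(Z)`: the `P`-primary component of `I(Z)`, i.e. the contraction of `I(Z) R_P`. -/
def componentIdeal {k : Type*} [Field k] {n : ℕ} (Z : ZeroDimScheme k n)
    (P : Ideal (MvPolynomial (Fin (n + 1)) k)) [P.IsPrime] :
    Ideal (MvPolynomial (Fin (n + 1)) k) :=
  (Z.ideal.map (algebraMap _ (Localization.AtPrime P))).comap
    (algebraMap _ (Localization.AtPrime P))

/-! ### Points and linear forms -/

/-- The linear form `a_0 X_0 + … + a_n X_n`. -/
def linForm {k : Type*} [Field k] {n : ℕ} (a : Fin (n + 1) → k) : MvPolynomial (Fin (n + 1)) k :=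
  ∑ i, C (a i) * X i

/-- The coefficient vector of a linear form. -/
def coeffVec {k : Type*} [Field k] {n : ℕ} (L : MvPolynomial (Fin (n + 1)) k) : Fin (n + 1) → k :=
  fun i => coeff (Finsupp.single i 1) L

/-- `℘_L`: the homogeneous ideal in `R` of the point `[L] ∈ ℙ^n = ℙ(S_1)`. -/
def pointIdeal {k : Type*} [Field k] {n : ℕ} (L : MvPolynomial (Fin (n + 1)) k) :
    Ideal (MvPolynomial (Fin (n + 1)) k) :=
  Ideal.span {G | (∃ e, G.IsHomogeneous e) ∧ eval (coeffVec L) G = 0}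

theorem linForm_coeffVec {k : Type*} [Field k] {n : ℕ} (L : MvPolynomial (Fin (n + 1)) k)
    (hL : L.IsHomogeneous 1) : linForm (coeffVec L) = L := by
  classical
  ext α
  simp only [linForm, coeffVec, coeff_sum, coeff_C_mul, coeff_X, mul_ite, mul_one, mul_zero]
  by_cases hα : α.degree = 1
  · obtain ⟨i, rfl⟩ := (Finsupp.sum_eq_one_iff α).1 hα
    rw [Finset.sum_eq_single i]
    · simp
    · intro j _ hj
      rw [if_neg]
      intro h
      exact hj ((Finsupp.single_left_inj one_ne_zero).1 h)
    · simp
  · rw [hL.coeff_eq_zero hα]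
    refine Finset.sum_eq_zero fun i _ => ?_
    rw [if_neg]
    rintro rfl
    exact hα (by simp)

/-- A nonzero linear form is the first element of a basis `L_0 = L, L_1, …, L_n` of `S_1`, the rows
of an invertible matrix. -/
theorem exists_coords {k : Type*} [Field k] {n : ℕ} (L : MvPolynomial (Fin (n + 1)) k)
    (hL : L.IsHomogeneous 1) (hL0 : L ≠ 0) :
    ∃ A : Matrix.GeneralLinearGroup (Fin (n + 1)) k, linForm (A.1 0) = L := by
  classical
  obtain ⟨j, hj⟩ : ∃ j, coeffVec L j ≠ 0 := by
    by_contra! h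
    apply hL0
    rw [← linForm_coeffVec L hL]
    simp [linForm, h]
  let M : Matrix (Fin (n + 1)) (Fin (n + 1)) k :=
    Matrix.of (Fin.cons (coeffVec L) fun i => Pi.single (j.succAbove i) 1)
  have hM : M.det ≠ 0 := by
    intro h
    obtain ⟨v, hv, hMv⟩ := Matrix.exists_mulVec_eq_zero_iff.2 h
    have h1 : ∀ i, v (j.succAbove i) = 0 := fun i => by
      have := congrFun hMv i.succ
      simpa [M, Matrix.mulVec, dotProduct, Pi.single_apply] using this
    have h2 : v j = 0 := by
      have := congrFun hMv 0
      simp only [M, Matrix.mulVec, dotProduct, Matrix.of_apply, Fin.cons_zero, Pi.zero_apply] at this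
      rw [Fin.sum_univ_succAbove _ j] at this
      simpa [h1, hj] using this
    apply hv
    funext i
    rcases Fin.eq_self_or_eq_succAbove j i with rfl | ⟨i', rfl⟩
    · exact h2
    · exact h1 i'
  refine ⟨Matrix.GeneralLinearGroup.mkOfDetNeZero M hM, ?_⟩
  exact linForm_coeffVec L hL

/-! ### Natural apolar schemes

Coordinates are given by an invertible matrix `A` whose rows are the coefficient vectors of a basis
`L_0, …, L_n` of `S_1`. -/

/-- `F` rewritten in the coordinates `L_0, …, L_n`, i.e. the `F'` with `F = F'(L_0, …, L_n)`. -/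
def changeCoords {k : Type*} [Field k] {n : ℕ} (A : Matrix.GeneralLinearGroup (Fin (n + 1)) k)
    (F : MvPolynomial (Fin (n + 1)) k) : MvPolynomial (Fin (n + 1)) k :=
  aeval (fun i => linForm ((A⁻¹).1 i)) F

/-- The contragredient change of coordinates of `R`: it sends `Y_i` to the `i`-th element of the
basis of `R_1` that is dual to `L_0, …, L_n`. -/
def dualCoords {k : Type*} [Field k] {n : ℕ} (A : Matrix.GeneralLinearGroup (Fin (n + 1)) k) :
    MvPolynomial (Fin (n + 1)) k →ₐ[k] MvPolynomial (Fin (n + 1)) k :=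
  aeval fun i => linForm fun j => (A⁻¹).1 j i

/-- The dehomogenization `X_0^[a] ↦ 1` (`X_i ↦ x_i` for `i ≥ 1`) in the divided power basis. -/
def dehom {k : Type*} [Field k] {n : ℕ} (F : MvPolynomial (Fin (n + 1)) k) :
    MvPolynomial (Fin n) k :=
  aeval (Fin.cons 1 X : Fin (n + 1) → MvPolynomial (Fin n) k) F

/-- The homogenization of `g ∈ k[y_1, …, y_n]` with respect to `Y_0`. -/
def homog {k : Type*} [Field k] {n : ℕ} (g : MvPolynomial (Fin n) k) :
    MvPolynomial (Fin (n + 1)) k :=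
  ∑ β ∈ g.support, monomial (Finsupp.cons (g.totalDegree - β.degree) β) (coeff β g)

/-- The homogenization of an ideal of `k[y_1, …, y_n]`. -/
def homogIdeal {k : Type*} [Field k] {n : ℕ} (J : Ideal (MvPolynomial (Fin n) k)) :
    Ideal (MvPolynomial (Fin (n + 1)) k) :=
  Ideal.span (homog '' (J : Set (MvPolynomial (Fin n) k)))

/-- The ideal of the natural apolar scheme to `F` supported at `L_0`, computed in the coordinates
`L_0, …, L_n`: dehomogenize `F_dp` by `L_0`, take the annihilator by contraction, homogenize, and
return to the original coordinates. -/
def naturalApolarIdealIn {k : Type*} [Field k] {n : ℕ}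
    (A : Matrix.GeneralLinearGroup (Fin (n + 1)) k) (F : MvPolynomial (Fin (n + 1)) k) :
    Ideal (MvPolynomial (Fin (n + 1)) k) :=
  (homogIdeal (contractAnn (dehom (toDP (changeCoords A F))))).map (dualCoords A)

open Classical in
/-- The ideal `I(Z_{F,L})` of the natural apolar scheme to `F` supported at `[L]`, computed in a
basis of `S_1` whose first element is `L` (the choice of the basis is arbitrary and immaterial; such
a basis exists for every nonzero linear form, see `exists_coords`). -/
def naturalApolarIdeal {k : Type*} [Field k] {n : ℕ} (F L : MvPolynomial (Fin (n + 1)) k) :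
    Ideal (MvPolynomial (Fin (n + 1)) k) :=
  if h : ∃ A : Matrix.GeneralLinearGroup (Fin (n + 1)) k, linForm (A.1 0) = L then
    naturalApolarIdealIn h.choose F
  else ⊤

/-! ### Generalized additive decompositions -/

/-- A generalized additive decomposition `F = ∑ L_i^(d - k_i) G_i` of `F ∈ S_d`. -/
structure GAD {k : Type*} [Field k] {n : ℕ} (d : ℕ) (F : MvPolynomial (Fin (n + 1)) k) where
  /-- The number of summands. -/
  s : ℕ
  /-- The linear forms `L_i`. -/
  L : Fin s → MvPolynomial (Fin (n + 1)) k
  /-- The degrees `k_i`. -/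
  deg : Fin s → ℕ
  /-- The forms `G_i`. -/
  G : Fin s → MvPolynomial (Fin (n + 1)) k
  L_homogeneous : ∀ i, (L i).IsHomogeneous 1
  L_ne_zero : ∀ i, L i ≠ 0
  L_not_proportional : ∀ i j, i ≠ j → ∀ c : k, L i ≠ c • L j
  deg_le : ∀ i, deg i ≤ d
  G_homogeneous : ∀ i, (G i).IsHomogeneous (deg i)
  not_dvd : ∀ i, ¬ L i ∣ G i
  sum_eq : F = ∑ i, L i ^ (d - deg i) * G i

/-- `Z` is the scheme evinced by the decomposition: the union of the natural apolar schemes to the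
summands `L_i^(d - k_i) G_i` supported at `[L_i]`. -/
def IsEvincedBy {k : Type*} [Field k] {n d : ℕ} {F : MvPolynomial (Fin (n + 1)) k}
    (Z : ZeroDimScheme k n) (D : GAD d F) : Prop :=
  Z.ideal = ⨅ i, naturalApolarIdeal (D.L i ^ (d - D.deg i) * D.G i) (D.L i)

end Apolarity

end

noncomputable section

namespace Apolarity

attribute [local instance] MvPolynomial.gradedAlgebra

/-! ### Differentiation versus contraction -/

/-! The implications are proved in the cycle 1 ⇒ 2 ⇒ 3 ⇒ 1; irredundancy enters only in the last
one.

1 ⇒ 2. In coordinates with `L` first, the dehomogenization of a form of degree `d` has degree at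
most `d`, so contraction by any operator of order at least `d + 1` kills it. Hence every natural
apolar ideal of a form of degree `d` contains `℘_L^(d+1)` (`pointIdeal_pow_le_naturalApolarIdeal`).

2 ⇒ 3. Localize at a minimal prime `P`: fat points away from `P` become trivial, and those whose
ideal lies in `P` all sit at the same point (`exists_pointIdeal_pow_le_componentIdeal`).

3 ⇒ 1. Each minimal prime is then some `℘_L`, and saturation makes `I(Z)` the intersection of its
components `Q_P`. In degree `d`, the orthogonal of a finite intersection is the sum of the
orthogonals, so `F = ∑ f_P` with `f_P` orthogonal to the degree `d` part of `Q_P`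
(`exists_sum_eq_of_iInf_apolar`). The crux is that this condition in the single degree `d` already
gives `Q_P ⊆ I(Z_{f_P, L_P})` (`le_naturalApolarIdeal`). Terms of order above `d` in the local
variables lie in `Q_P` by the fat point hypothesis, and what remains can be moved to degree exactly
`d` by multiplying and cancelling powers of the variable that does not vanish at the point. So the
union of the natural apolar schemes of the nonzero `f_P` is a subscheme of `Z`, and it is apolar to
`F`. Irredundancy forces equality, and extracting from `f_P` the highest power of `L_P` gives the
decomposition. -/

theorem coeff_toDP {k : Type*} [Field k] {m : ℕ} (F : MvPolynomial (Fin m) k) (γ : Fin m →₀ ℕ) :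
    coeff γ (toDP F) = ((∏ i, (γ i).factorial : ℕ) : k) * coeff γ F := by
  classical
  simp only [toDP, coeff_sum, coeff_monomial]
  rw [Finset.sum_ite_eq' F.support γ]
  split_ifs with h
  · rfl
  · rw [notMem_support_iff.1 h, mul_zero]

theorem toDP_injective {k : Type*} [Field k] [CharZero k] {m : ℕ} :
    Function.Injective (toDP : MvPolynomial (Fin m) k → MvPolynomial (Fin m) k) := by
  intro F G h
  ext γ
  have := congrArg (coeff γ) h
  rw [coeff_toDP, coeff_toDP] at this
  refine mul_left_cancel₀ ?_ this
  exact Nat.cast_ne_zero.2 (Finset.prod_ne_zero_iff.2 fun i _ => Nat.factorial_ne_zero _)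

theorem coeff_diffAct {k : Type*} [Field k] {m : ℕ} (G F : MvPolynomial (Fin m) k)
    (γ : Fin m →₀ ℕ) :
    coeff γ (diffAct G F) = ∑ β ∈ G.support,
      coeff β G * coeff (β + γ) F * ((∏ i, ((β + γ) i).descFactorial (β i) : ℕ) : k) := by
  classical
  simp only [diffAct, coeff_sum]
  refine Finset.sum_congr rfl fun β _ => ?_
  have h : ∀ α ∈ F.support, α ≠ β + γ →
      coeff γ (if β ≤ α then monomial (α - β)
        (coeff β G * coeff α F * ((∏ i, (α i).descFactorial (β i) : ℕ) : k)) else 0) = 0 := by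
    intro α _ hα
    split_ifs with hle
    · rw [coeff_monomial, if_neg]
      rintro rfl
      exact hα (add_tsub_cancel_of_le hle).symm
    · exact coeff_zero _
  rw [Finset.sum_eq_single (β + γ) h]
  · rw [if_pos (le_self_add), coeff_monomial, if_pos (add_tsub_cancel_left β γ)]
  · intro hn
    rw [notMem_support_iff.1 hn]
    simp

/-- Coefficientwise this is `γ!` times the descending factorial `(β+γ)!/γ!`. In characteristic zero
`toDP` is injective, so the algebra of the differentiation action can be pulled back from
contraction. -/
theorem toDP_diffAct {k : Type*} [Field k] {m : ℕ} (G F : MvPolynomial (Fin m) k) :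
    toDP (diffAct G F) = contract G (toDP F) := by
  ext γ
  rw [coeff_toDP, coeff_diffAct, coeff_contract, Finset.mul_sum]
  refine Finset.sum_congr rfl fun β _ => ?_
  have h : (∏ i, (γ i).factorial) * ∏ i, ((β + γ) i).descFactorial (β i) =
      ∏ i, ((β + γ) i).factorial := by
    rw [← Finset.prod_mul_distrib]
    refine Finset.prod_congr rfl fun i _ => ?_
    have := Nat.factorial_mul_descFactorial (n := (β + γ) i) (k := β i) (by simp)
    rwa [Finsupp.add_apply, Nat.add_sub_cancel_left] at this
  rw [coeff_toDP, ← h, Nat.cast_mul]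
  ring

section Action

variable {k : Type*} [Field k] {m : ℕ}

theorem diffAct_eq_zero_iff [CharZero k] (G F : MvPolynomial (Fin m) k) :
    diffAct G F = 0 ↔ contract G (toDP F) = 0 := by
  rw [← toDP_diffAct]
  refine ⟨fun h => by rw [h]; simp [toDP], fun h => toDP_injective ?_⟩
  rw [h]
  simp [toDP]

theorem toDP_add (F G : MvPolynomial (Fin m) k) : toDP (F + G) = toDP F + toDP G := by
  ext γ
  simp [coeff_toDP, mul_add]

theorem contract_add_right (g f f' : MvPolynomial (Fin m) k) :
    contract g (f + f') = contract g f + contract g f' := by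
  ext γ
  simp [coeff_contract, mul_add, Finset.sum_add_distrib]

theorem diffAct_add_left [CharZero k] (G H F : MvPolynomial (Fin m) k) :
    diffAct (G + H) F = diffAct G F + diffAct H F :=
  toDP_injective (by simp only [toDP_add, toDP_diffAct, contract_add_left])

theorem diffAct_add_right [CharZero k] (G F F' : MvPolynomial (Fin m) k) :
    diffAct G (F + F') = diffAct G F + diffAct G F' :=
  toDP_injective (by simp only [toDP_add, toDP_diffAct, contract_add_right])

theorem diffAct_zero_right (G : MvPolynomial (Fin m) k) : diffAct G 0 = 0 := by
  simp [diffAct]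

theorem diffAct_sum_right {ι : Type*} [CharZero k] (s : Finset ι) (G : MvPolynomial (Fin m) k)
    (F : ι → MvPolynomial (Fin m) k) : diffAct G (∑ i ∈ s, F i) = ∑ i ∈ s, diffAct G (F i) := by
  classical
  induction s using Finset.induction_on with
  | empty => simp [diffAct_zero_right]
  | insert a s ha ih => rw [Finset.sum_insert ha, Finset.sum_insert ha, diffAct_add_right, ih]

theorem diffAct_mul [CharZero k] (G H F : MvPolynomial (Fin m) k) :
    diffAct (G * H) F = diffAct G (diffAct H F) :=
  toDP_injective (by simp only [toDP_diffAct, mul_contract])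

theorem diffAct_monomial (β : Fin m →₀ ℕ) (c : k) (F : MvPolynomial (Fin m) k)
    (γ : Fin m →₀ ℕ) : coeff γ (diffAct (monomial β c) F) =
      c * coeff (β + γ) F * ((∏ i, ((β + γ) i).descFactorial (β i) : ℕ) : k) := by
  classical
  rw [coeff_diffAct]
  by_cases hc : c = 0
  · simp [hc]
  · rw [support_monomial, if_neg hc, Finset.sum_singleton, coeff_monomial, if_pos rfl]

theorem diffAct_C (c : k) (F : MvPolynomial (Fin m) k) : diffAct (C c) F = C c * F := by
  ext γ
  rw [← monomial_zero', diffAct_monomial]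
  simp

theorem diffAct_X (i : Fin m) (F : MvPolynomial (Fin m) k) : diffAct (X i) F = pderiv i F := by
  classical
  ext γ
  rw [X, diffAct_monomial, coeff_pderiv, add_comm γ, Finset.prod_eq_single i]
  · simp [add_comm]
  · intro j _ hj
    simp [Finsupp.single_eq_of_ne hj]
  · simp

theorem diffAct_linForm [CharZero k] {n : ℕ} (a : Fin (n + 1) → k) (F : MvPolynomial (Fin (n + 1)) k) :
    diffAct (linForm a) F = ∑ i, C (a i) * pderiv i F := by
  classical
  have : ∀ s : Finset (Fin (n + 1)), diffAct (∑ i ∈ s, C (a i) * X i) F =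
      ∑ i ∈ s, C (a i) * pderiv i F := by
    intro s
    induction s using Finset.induction_on with
    | empty => simp [diffAct]
    | insert i s hi ih =>
      rw [Finset.sum_insert hi, Finset.sum_insert hi, diffAct_add_left, ih, diffAct_mul, diffAct_X,
        diffAct_C]
  exact this _

end Action

/-! ### Linear changes of coordinates -/

section Coordinates

variable {k : Type*} [Field k] {n : ℕ} (A : Matrix.GeneralLinearGroup (Fin (n + 1)) k)

theorem linForm_isHomogeneous (a : Fin (n + 1) → k) : (linForm a).IsHomogeneous 1 :=
  IsHomogeneous.sum _ _ _ fun i _ => isHomogeneous_C_mul_X (a i) i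

theorem coeffVec_linForm (a : Fin (n + 1) → k) : coeffVec (linForm a) = a := by
  classical
  funext i
  simp [coeffVec, linForm, coeff_sum, coeff_C_mul, coeff_X, Finsupp.single_left_inj]

theorem changeCoords_add (F G : MvPolynomial (Fin (n + 1)) k) :
    changeCoords A (F + G) = changeCoords A F + changeCoords A G :=
  map_add _ _ _

theorem aeval_linForm_isHomogeneous (M : Matrix (Fin (n + 1)) (Fin (n + 1)) k)
    {F : MvPolynomial (Fin (n + 1)) k} {d : ℕ} (hF : F.IsHomogeneous d) :
    (aeval (fun i => linForm (M i)) F).IsHomogeneous d := by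
  have := hF.aeval (fun i => linForm (M i)) fun i => linForm_isHomogeneous (M i)
  rwa [one_mul] at this

theorem changeCoords_isHomogeneous {F : MvPolynomial (Fin (n + 1)) k} {d : ℕ}
    (hF : F.IsHomogeneous d) : (changeCoords A F).IsHomogeneous d :=
  aeval_linForm_isHomogeneous (A⁻¹).1 hF

theorem dualCoords_isHomogeneous {F : MvPolynomial (Fin (n + 1)) k} {d : ℕ}
    (hF : F.IsHomogeneous d) : (dualCoords A F).IsHomogeneous d :=
  aeval_linForm_isHomogeneous (A⁻¹).1.transpose hF

theorem aeval_linForm (B : Fin (n + 1) → MvPolynomial (Fin (n + 1)) k) (a : Fin (n + 1) → k) :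
    aeval B (linForm a) = ∑ i, C (a i) * B i := by
  simp [linForm, algebraMap_eq]

theorem aeval_linForm_linForm (M : Matrix (Fin (n + 1)) (Fin (n + 1)) k) (a : Fin (n + 1) → k) :
    aeval (fun i => linForm (M i)) (linForm a) = linForm (Matrix.vecMul a M) := by
  rw [aeval_linForm]
  simp only [linForm, Finset.mul_sum, Matrix.vecMul, dotProduct, map_sum, Finset.sum_mul, C_mul]
  rw [Finset.sum_comm]
  simp only [mul_assoc]

theorem aeval_linForm_comp (M N : Matrix (Fin (n + 1)) (Fin (n + 1)) k) (h : N * M = 1)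
    (F : MvPolynomial (Fin (n + 1)) k) :
    aeval (fun i => linForm (M i)) (aeval (fun i => linForm (N i)) F) = F := by
  have : (aeval fun i => linForm (M i)).comp (aeval fun i => linForm (N i)) =
      AlgHom.id k (MvPolynomial (Fin (n + 1)) k) := by
    ext1 i
    rw [AlgHom.comp_apply, aeval_X, aeval_linForm_linForm]
    have hi : Matrix.vecMul (N i) M = (1 : Matrix (Fin (n + 1)) (Fin (n + 1)) k) i := by
      rw [← h]; rfl
    rw [hi]
    simp [linForm, Matrix.one_apply]
  exact DFunLike.congr_fun this F

theorem changeCoords_injective : Function.Injective (changeCoords A) := by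
  refine Function.LeftInverse.injective (g := aeval fun i => linForm (A.1 i)) fun F => ?_
  exact aeval_linForm_comp A.1 (A⁻¹).1 (by rw [← Units.val_mul]; simp) F

/-- The inverse of `dualCoords A`. -/
def dualCoordsInv : MvPolynomial (Fin (n + 1)) k →ₐ[k] MvPolynomial (Fin (n + 1)) k :=
  aeval fun i => linForm fun j => A.1 j i

theorem dualCoords_dualCoordsInv (F : MvPolynomial (Fin (n + 1)) k) :
    dualCoords A (dualCoordsInv A F) = F :=
  aeval_linForm_comp (A⁻¹).1.transpose A.1.transpose
    (by rw [← Matrix.transpose_mul, ← Units.val_mul]; simp) F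

theorem dualCoordsInv_dualCoords (F : MvPolynomial (Fin (n + 1)) k) :
    dualCoordsInv A (dualCoords A F) = F :=
  aeval_linForm_comp A.1.transpose (A⁻¹).1.transpose
    (by rw [← Matrix.transpose_mul, ← Units.val_mul]; simp) F

theorem dualCoordsInv_isHomogeneous {F : MvPolynomial (Fin (n + 1)) k} {d : ℕ}
    (hF : F.IsHomogeneous d) : (dualCoordsInv A F).IsHomogeneous d :=
  aeval_linForm_isHomogeneous A.1.transpose hF

theorem mem_map_dualCoords (I : Ideal (MvPolynomial (Fin (n + 1)) k))
    (G : MvPolynomial (Fin (n + 1)) k) : G ∈ I.map (dualCoords A) ↔ dualCoordsInv A G ∈ I := by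
  constructor
  · intro h
    have h2 : I.map (dualCoords A) ≤ I.comap (dualCoordsInv A) := by
      rw [Ideal.map_le_iff_le_comap]
      intro H hH
      simpa [Ideal.mem_comap, dualCoordsInv_dualCoords] using hH
    exact h2 h
  · intro h
    simpa [dualCoords_dualCoordsInv] using Ideal.mem_map_of_mem (dualCoords A) h

theorem eval_dualCoordsInv (G : MvPolynomial (Fin (n + 1)) k) :
    eval (Pi.single 0 1) (dualCoordsInv A G) = eval (A.1 0) G := by
  classical
  unfold dualCoordsInv
  induction G using MvPolynomial.induction_on with
  | C a => simp [algebraMap_eq]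
  | add p q hp hq => simp only [map_add, hp, hq]
  | mul_X p i hp =>
    rw [map_mul, aeval_X, map_mul, hp, map_mul, eval_X]
    simp [linForm, Pi.single_apply]

theorem pderiv_changeCoords (i : Fin (n + 1)) (F : MvPolynomial (Fin (n + 1)) k) :
    pderiv i (changeCoords A F) =
      changeCoords A (∑ j, C ((A⁻¹).1 j i) * pderiv j F) := by
  classical
  unfold changeCoords
  induction F using MvPolynomial.induction_on with
  | C a => simp
  | add p q hp hq =>
    simp only [map_add, hp, hq, mul_add, Finset.sum_add_distrib]
  | mul_X p j hp =>
    simp only [map_mul, Derivation.leibniz, hp, aeval_X, smul_eq_mul, pderiv_X, map_sum, map_add,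
      mul_add, Finset.sum_add_distrib, aeval_C, Finset.mul_sum, algebraMap_eq]
    congr 1
    · simp [linForm, pderiv_X, Pi.single_apply]
      ring
    · exact Finset.sum_congr rfl fun l _ => by ring

/-- Equivariance of the pairing under contragredient changes of coordinates. On a variable it is the
chain rule `pderiv_changeCoords`; both sides are compatible with sums and composition of operators.
-/
theorem changeCoords_diffAct [CharZero k] (G F : MvPolynomial (Fin (n + 1)) k) :
    changeCoords A (diffAct (dualCoords A G) F) = diffAct G (changeCoords A F) := by
  induction G using MvPolynomial.induction_on generalizing F with
  | C a =>
    rw [dualCoords, aeval_C, algebraMap_eq, diffAct_C, diffAct_C]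
    simp [changeCoords, algebraMap_eq]
  | add p q hp hq => rw [map_add, diffAct_add_left, changeCoords_add, hp, hq, diffAct_add_left]
  | mul_X p i hp =>
    rw [map_mul, diffAct_mul, diffAct_mul, hp, diffAct_X, pderiv_changeCoords]
    congr 2
    rw [dualCoords, aeval_X, diffAct_linForm]

theorem coeff_zero_changeCoords (F : MvPolynomial (Fin (n + 1)) k) :
    coeff 0 (changeCoords A F) = coeff 0 F := by
  unfold changeCoords
  induction F using MvPolynomial.induction_on with
  | C a => simp [algebraMap_eq]
  | add p q hp hq => simp only [map_add, coeff_add, hp, hq]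
  | mul_X p i hp =>
    rw [map_mul, aeval_X]
    change constantCoeff _ = constantCoeff _
    rw [map_mul, map_mul]
    simp [linForm]

end Coordinates

/-! ### Homogenization and dehomogenization -/

section Homogenization

variable {k : Type*} [Field k] {n : ℕ}

theorem degree_cons (a : ℕ) (β : Fin n →₀ ℕ) : (Finsupp.cons a β).degree = a + β.degree := by
  simp [Finsupp.degree_eq_sum, Fin.sum_univ_succ]

theorem degree_eq_add_tail (α : Fin (n + 1) →₀ ℕ) : α.degree = α 0 + α.tail.degree := by
  conv_lhs => rw [← Finsupp.cons_tail α, degree_cons]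

theorem cons_add_cons (a b : ℕ) (β γ : Fin n →₀ ℕ) :
    Finsupp.cons a β + Finsupp.cons b γ = Finsupp.cons (a + b) (β + γ) := by
  ext i
  refine Fin.cases ?_ (fun i => ?_) i <;> simp

theorem contract_sum_left {m : ℕ} {ι : Type*} (s : Finset ι) (g : ι → MvPolynomial (Fin m) k)
    (f : MvPolynomial (Fin m) k) : contract (∑ i ∈ s, g i) f = ∑ i ∈ s, contract (g i) f := by
  classical
  induction s using Finset.induction_on with
  | empty => simp [contract_zero_left]
  | insert a s ha ih => rw [Finset.sum_insert ha, Finset.sum_insert ha, contract_add_left, ih]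

theorem coeff_contract_monomial {m : ℕ} (β γ : Fin m →₀ ℕ) (c : k) (f : MvPolynomial (Fin m) k) :
    coeff γ (contract (monomial β c) f) = c * coeff (β + γ) f := by
  rw [contract_monomial_left, coeff_smul, coeff_divMonomial, smul_eq_mul]

/-- `dehom` as a homomorphism of algebras. -/
def dehomHom : MvPolynomial (Fin (n + 1)) k →ₐ[k] MvPolynomial (Fin n) k :=
  aeval (Fin.cons 1 X : Fin (n + 1) → MvPolynomial (Fin n) k)

theorem dehomHom_apply (G : MvPolynomial (Fin (n + 1)) k) : dehomHom G = dehom G := rfl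

theorem dehomHom_monomial (α : Fin (n + 1) →₀ ℕ) (c : k) :
    dehomHom (monomial α c) = monomial α.tail c := by
  rw [dehomHom, aeval_monomial, monomial_eq, algebraMap_eq, Finsupp.prod_fintype _ _ (by simp),
    Finsupp.prod_fintype _ _ (by simp), Fin.prod_univ_succ]
  simp [Finsupp.tail_apply]

theorem dehom_eq_sum (G : MvPolynomial (Fin (n + 1)) k) :
    dehom G = ∑ α ∈ G.support, monomial α.tail (coeff α G) := by
  conv_lhs => rw [← dehomHom_apply, ← support_sum_monomial_coeff G, map_sum]
  exact Finset.sum_congr rfl fun α _ => dehomHom_monomial _ _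

theorem eq_cons_of_mem_support {G : MvPolynomial (Fin (n + 1)) k} {e : ℕ} (hG : G.IsHomogeneous e)
    {α : Fin (n + 1) →₀ ℕ} (hα : α ∈ G.support) :
    α.tail.degree ≤ e ∧ α = Finsupp.cons (e - α.tail.degree) α.tail := by
  have h : α.degree = e := by
    by_contra h
    exact mem_support_iff.1 hα (hG.coeff_eq_zero h)
  have h2 := degree_eq_add_tail α
  refine ⟨by omega, ?_⟩
  conv_lhs => rw [← Finsupp.cons_tail α]
  congr 1
  omega

theorem coeff_dehom {G : MvPolynomial (Fin (n + 1)) k} {e : ℕ} (hG : G.IsHomogeneous e)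
    (β : Fin n →₀ ℕ) : coeff β (dehom G) =
      if β.degree ≤ e then coeff (Finsupp.cons (e - β.degree) β) G else 0 := by
  classical
  simp only [dehom_eq_sum, coeff_sum, coeff_monomial]
  split_ifs with h
  · rw [Finset.sum_eq_single (Finsupp.cons (e - β.degree) β)]
    · rw [Finsupp.tail_cons, if_pos rfl]
    · intro α hα hne
      rw [if_neg]
      rintro rfl
      exact hne (eq_cons_of_mem_support hG hα).2
    · intro hn
      rw [notMem_support_iff.1 hn, ite_self]
  · refine Finset.sum_eq_zero fun α hα => ?_
    rw [if_neg]
    rintro rfl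
    exact h (eq_cons_of_mem_support hG hα).1

theorem dehom_injective_of_isHomogeneous {G H : MvPolynomial (Fin (n + 1)) k} {e : ℕ}
    (hG : G.IsHomogeneous e) (hH : H.IsHomogeneous e) (h : dehom G = dehom H) : G = H := by
  ext α
  by_cases hα : α.degree = e
  · have h2 := degree_eq_add_tail α
    have h3 := congrArg (coeff α.tail) h
    rw [coeff_dehom hG, coeff_dehom hH, if_pos (by omega), if_pos (by omega)] at h3
    have h4 : Finsupp.cons (e - α.tail.degree) α.tail = α := by
      conv_rhs => rw [← Finsupp.cons_tail α]
      congr 1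
      omega
    rwa [h4] at h3
  · rw [hG.coeff_eq_zero hα, hH.coeff_eq_zero hα]

theorem totalDegree_dehom_le {G : MvPolynomial (Fin (n + 1)) k} {e : ℕ} (hG : G.IsHomogeneous e) :
    (dehom G).totalDegree ≤ e := by
  refine Finset.sup_le fun β hβ => ?_
  rw [mem_support_iff, coeff_dehom hG] at hβ
  by_contra h
  refine hβ (if_neg ?_)
  simpa [Finsupp.degree_eq_sum, Finsupp.sum_fintype] using h

theorem homog_isHomogeneous (g : MvPolynomial (Fin n) k) :
    (homog g).IsHomogeneous g.totalDegree := by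
  refine IsHomogeneous.sum _ _ _ fun β hβ => isHomogeneous_monomial _ ?_
  have : β.degree ≤ g.totalDegree := by
    simpa [Finsupp.degree_eq_sum, Finsupp.sum_fintype] using le_totalDegree hβ
  rw [degree_cons]
  omega

theorem dehom_homog (g : MvPolynomial (Fin n) k) : dehom (homog g) = g := by
  rw [homog, ← dehomHom_apply, map_sum]
  simp only [dehomHom_monomial, Finsupp.tail_cons]
  exact support_sum_monomial_coeff g

theorem dehom_X_zero_pow_mul (a : ℕ) (G : MvPolynomial (Fin (n + 1)) k) :
    dehom (X 0 ^ a * G) = dehom G := by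
  rw [← dehomHom_apply, map_mul, map_pow, dehomHom, aeval_X, Fin.cons_zero, one_pow, one_mul]
  rfl

theorem homogIdeal_isHomogeneous (J : Ideal (MvPolynomial (Fin n) k)) :
    (homogIdeal J).IsHomogeneous (homogeneousSubmodule (Fin (n + 1)) k) := by
  refine Ideal.homogeneous_span _ _ ?_
  rintro _ ⟨g, _, rfl⟩
  exact ⟨_, homog_isHomogeneous g⟩

/-- A form is determined by its degree and its dehomogenization, so `G` is `X 0 ^ (e - deg)` times
the homogenization of `dehom G`. This reduces membership questions to the affine chart. -/
theorem mem_homogIdeal_iff (J : Ideal (MvPolynomial (Fin n) k)) {G : MvPolynomial (Fin (n + 1)) k}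
    {e : ℕ} (hG : G.IsHomogeneous e) : G ∈ homogIdeal J ↔ dehom G ∈ J := by
  constructor
  · intro h
    have h2 : homogIdeal J ≤ J.comap dehomHom := by
      refine Ideal.span_le.2 ?_
      rintro _ ⟨g, hg, rfl⟩
      change dehomHom (homog g) ∈ J
      rwa [dehomHom_apply, dehom_homog]
    exact h2 h
  · intro h
    have h2 : G = X 0 ^ (e - (dehom G).totalDegree) * homog (dehom G) := by
      refine dehom_injective_of_isHomogeneous hG ?_ ?_
      · have := (isHomogeneous_X_pow (R := k) (0 : Fin (n + 1))
          (e - (dehom G).totalDegree)).mul (homog_isHomogeneous (dehom G))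
        rwa [Nat.sub_add_cancel (totalDegree_dehom_le hG)] at this
      · rw [dehom_X_zero_pow_mul, dehom_homog]
    rw [h2]
    exact Ideal.mul_mem_left _ _ (Ideal.subset_span ⟨_, h, rfl⟩)

theorem mem_of_homogeneousComponent_mem {m : ℕ} (I : Ideal (MvPolynomial (Fin m) k))
    (G : MvPolynomial (Fin m) k) (h : ∀ e, homogeneousComponent e G ∈ I) : G ∈ I := by
  rw [← sum_homogeneousComponent G]
  exact Ideal.sum_mem _ fun e _ => h e

theorem coe_decompose_eq_homogeneousComponent {m : ℕ} (G : MvPolynomial (Fin m) k) (i : ℕ) :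
    (DirectSum.decompose (homogeneousSubmodule (Fin m) k) G i : MvPolynomial (Fin m) k) =
      homogeneousComponent i G :=
  decomposition.decompose'_apply G i

theorem isHomogeneous_of_homogeneousComponent_mem {m : ℕ} {I : Ideal (MvPolynomial (Fin m) k)}
    (h : ∀ i, ∀ G ∈ I, homogeneousComponent i G ∈ I) :
    I.IsHomogeneous (homogeneousSubmodule (Fin m) k) := by
  intro i G hG
  rw [coe_decompose_eq_homogeneousComponent]
  exact h i G hG

theorem homogeneousComponent_mul_of_isHomogeneous {m : ℕ} (i : ℕ) {e : ℕ}
    (H : MvPolynomial (Fin m) k) {G : MvPolynomial (Fin m) k} (hG : G.IsHomogeneous e) :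
    homogeneousComponent (i + e) (H * G) = homogeneousComponent i H * G := by
  have h := DirectSum.coe_decompose_mul_add_of_right_mem (homogeneousSubmodule (Fin m) k)
    (i := i) (a := H) hG
  rwa [coe_decompose_eq_homogeneousComponent, coe_decompose_eq_homogeneousComponent] at h

theorem homogIdeal_saturated (J : Ideal (MvPolynomial (Fin n) k))
    (G : MvPolynomial (Fin (n + 1)) k) (hG : X 0 * G ∈ homogIdeal J) : G ∈ homogIdeal J := by
  refine mem_of_homogeneousComponent_mem _ _ fun e => ?_
  have h := homogeneousComponent_mem_of_mem (homogIdeal_isHomogeneous J) hG (e + 1)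
  rw [mul_comm, homogeneousComponent_mul_of_isHomogeneous _ _ (isHomogeneous_X k 0), mul_comm, mem_homogIdeal_iff J
    ((isHomogeneous_X k 0).mul (homogeneousComponent_isHomogeneous e G))] at h
  rw [mem_homogIdeal_iff J (homogeneousComponent_isHomogeneous e G)]
  simpa using (dehom_X_zero_pow_mul 1 (homogeneousComponent e G)) ▸ (by simpa using h)

/-! ### Natural apolar ideals in coordinates -/

theorem toDP_isHomogeneous {m d : ℕ} {F : MvPolynomial (Fin m) k} (hF : F.IsHomogeneous d) :
    (toDP F).IsHomogeneous d := by
  intro α hα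
  apply hF
  intro h
  rw [coeff_toDP, h, mul_zero] at hα
  exact hα rfl

theorem coeff_contract_dehom (G : MvPolynomial (Fin (n + 1)) k) (f : MvPolynomial (Fin n) k)
    (γ : Fin n →₀ ℕ) : coeff γ (contract (dehom G) f) =
      ∑ α ∈ G.support, coeff α G * coeff (α.tail + γ) f := by
  rw [dehom_eq_sum, contract_sum_left, coeff_sum]
  exact Finset.sum_congr rfl fun α _ => coeff_contract_monomial _ _ _ _

/-- For a form `H` of degree `e`, the contraction `H F` lives in degree `d - e`. There the exponent
of `X 0` is determined by the others, so its coefficients already occur in the contraction of the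
dehomogenizations. -/
theorem contract_eq_zero_of_mem_homogIdeal {d : ℕ} {F : MvPolynomial (Fin (n + 1)) k}
    (hF : F.IsHomogeneous d) {G : MvPolynomial (Fin (n + 1)) k}
    (hG : G ∈ homogIdeal (contractAnn (dehom F))) : contract G F = 0 := by
  suffices h : G ∈ contractAnn F from h
  refine mem_of_homogeneousComponent_mem _ _ fun e => ?_
  have h1 := homogeneousComponent_mem_of_mem (homogIdeal_isHomogeneous _) hG e
  have hH := homogeneousComponent_isHomogeneous e G
  rw [mem_homogIdeal_iff _ hH] at h1
  generalize homogeneousComponent e G = H at h1 hH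
  change contract (dehom H) (dehom F) = 0 at h1
  change contract H F = 0
  ext γ
  rw [coeff_contract, coeff_zero]
  by_cases hγ : e + γ.degree = d
  · have h2 := congrArg (coeff γ.tail) h1
    rw [coeff_contract_dehom, coeff_zero] at h2
    rw [← h2]
    refine Finset.sum_congr rfl fun α hα => ?_
    obtain ⟨h3, h4⟩ := eq_cons_of_mem_support hH hα
    have h5 := degree_eq_add_tail γ
    rw [coeff_dehom hF, map_add, if_pos (by omega)]
    congr 2
    conv_lhs => rw [h4, ← Finsupp.cons_tail γ, cons_add_cons]
    congr 1
    omega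
  · refine Finset.sum_eq_zero fun β hβ => ?_
    rw [hF.coeff_eq_zero, mul_zero]
    have : β.degree = e := by
      by_contra h
      exact mem_support_iff.1 hβ (hH.coeff_eq_zero h)
    rw [map_add]
    omega

theorem idealOfVars_pow_le_contractAnn {m d : ℕ} {f : MvPolynomial (Fin m) k}
    (hf : f.totalDegree ≤ d) : idealOfVars (Fin m) k ^ (d + 1) ≤ contractAnn f := by
  intro g hg
  rw [mem_pow_idealOfVars_iff'] at hg
  change contract g f = 0
  ext γ
  rw [coeff_contract, coeff_zero]
  refine Finset.sum_eq_zero fun β hβ => ?_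
  by_cases hd : β.degree < d + 1
  · rw [hg β hd, zero_mul]
  · rw [coeff_eq_zero_of_totalDegree_lt (f := f), mul_zero]
    have : f.totalDegree < (β + γ).degree := by
      rw [map_add]; omega
    exact this

/-- The step from degree `d` to every degree `e`: modulo terms of order above `d` in the variables
other than `X 0`, which lie in `Q` and do not see `dehom F`, the form `G` is traded for a form `H`
of degree `d` in `Q` with the same low-order dehomogenization. -/
theorem coeff_zero_contract_dehom_eq_zero {d : ℕ} {F : MvPolynomial (Fin (n + 1)) k}
    (hF : F.IsHomogeneous d) (Q : Ideal (MvPolynomial (Fin (n + 1)) k))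
    (hfat : ∀ (a : ℕ) (β : Fin n →₀ ℕ) (c : k), d < β.degree → monomial (Finsupp.cons a β) c ∈ Q)
    (hcancel : ∀ G, X 0 * G ∈ Q → G ∈ Q)
    (hQ : ∀ G ∈ Q, G.IsHomogeneous d → coeff 0 (contract G F) = 0)
    {e : ℕ} {G : MvPolynomial (Fin (n + 1)) k} (hG : G ∈ Q) (hGe : G.IsHomogeneous e) :
    coeff 0 (contract (dehom G) (dehom F)) = 0 := by
  classical
  have hcancel' : ∀ (a : ℕ) (H : MvPolynomial (Fin (n + 1)) k), X 0 ^ a * H ∈ Q → H ∈ Q := by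
    intro a
    induction a with
    | zero => simp
    | succ a ih =>
      intro H hH
      rw [pow_succ', mul_assoc] at hH
      exact ih _ (hcancel _ hH)
  have hX : ∀ (a b : ℕ) (β : Fin n →₀ ℕ) (c : k),
      (X 0 ^ a * monomial (Finsupp.cons b β) c : MvPolynomial (Fin (n + 1)) k) =
        monomial (Finsupp.cons (a + b) β) c := by
    intro a b β c
    rw [X_pow_eq_monomial, monomial_mul, one_mul, ← Finsupp.cons_zero_eq_single_zero,
      cons_add_cons, zero_add]
  set s := G.support.filter fun α => α.tail.degree ≤ d with hs
  set H : MvPolynomial (Fin (n + 1)) k :=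
    ∑ α ∈ s, monomial (Finsupp.cons (d - α.tail.degree) α.tail) (coeff α G) with hH
  have hHd : H.IsHomogeneous d := by
    refine IsHomogeneous.sum _ _ _ fun α hα => isHomogeneous_monomial _ ?_
    have := (Finset.mem_filter.1 hα).2
    rw [degree_cons]
    omega
  -- Both `X 0 ^ d * G` and `X 0 ^ e * H` have degree `d + e`, which avoids comparing `d` with `e`;
  -- they differ by terms in `Q`, and then `X 0 ^ e` is cancelled.
  have hHQ : H ∈ Q := by
    apply hcancel' e
    have h1 : X 0 ^ d * G = X 0 ^ e * H + ∑ α ∈ G.support.filter fun α => ¬ α.tail.degree ≤ d,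
        X 0 ^ d * monomial (Finsupp.cons (e - α.tail.degree) α.tail) (coeff α G) := by
      conv_lhs => rw [← support_sum_monomial_coeff G]
      rw [Finset.mul_sum, ← Finset.sum_filter_add_sum_filter_not _ fun α => α.tail.degree ≤ d]
      congr 1
      · rw [hH, Finset.mul_sum]
        refine Finset.sum_congr rfl fun α hα => ?_
        obtain ⟨h2, h3⟩ := Finset.mem_filter.1 hα
        obtain ⟨h4, h5⟩ := eq_cons_of_mem_support hGe h2
        conv_lhs => enter [2, 1]; rw [h5]
        rw [hX, hX, show d + (e - α.tail.degree) = e + (d - α.tail.degree) by omega]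
      · refine Finset.sum_congr rfl fun α hα => ?_
        obtain ⟨h4, h5⟩ := eq_cons_of_mem_support hGe (Finset.mem_filter.1 hα).1
        conv_lhs => enter [2, 1]; rw [h5]
    rw [← sub_eq_iff_eq_add] at h1
    rw [← h1]
    refine Q.sub_mem (Q.mul_mem_left _ hG) (Q.sum_mem fun α hα => Q.mul_mem_left _ (hfat _ _ _ ?_))
    exact not_le.1 (Finset.mem_filter.1 hα).2
  rw [← hQ H hHQ hHd, coeff_contract_dehom, hH, contract_sum_left, coeff_sum,
    ← Finset.sum_filter_add_sum_filter_not _ fun α => α.tail.degree ≤ d]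
  rw [Finset.sum_eq_zero (s := G.support.filter fun α => ¬ α.tail.degree ≤ d), add_zero]
  · refine Finset.sum_congr rfl fun α hα => ?_
    rw [coeff_contract_monomial, add_zero, add_zero, coeff_dehom hF,
      if_pos (Finset.mem_filter.1 hα).2]
  · intro α hα
    rw [add_zero, coeff_dehom hF, if_neg (Finset.mem_filter.1 hα).2, mul_zero]

/-- The coefficient at `γ` of a contraction by `g` is the constant term of the contraction by `y^γ
g`, and `Q` is closed under multiplication by monomials; so vanishing constant terms suffice. -/
theorem mem_homogIdeal_contractAnn {d : ℕ} {F : MvPolynomial (Fin (n + 1)) k}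
    (hF : F.IsHomogeneous d) (Q : Ideal (MvPolynomial (Fin (n + 1)) k))
    (hfat : ∀ (a : ℕ) (β : Fin n →₀ ℕ) (c : k), d < β.degree → monomial (Finsupp.cons a β) c ∈ Q)
    (hcancel : ∀ G, X 0 * G ∈ Q → G ∈ Q)
    (hQ : ∀ G ∈ Q, G.IsHomogeneous d → coeff 0 (contract G F) = 0)
    {e : ℕ} {G : MvPolynomial (Fin (n + 1)) k} (hG : G ∈ Q) (hGe : G.IsHomogeneous e) :
    G ∈ homogIdeal (contractAnn (dehom F)) := by
  rw [mem_homogIdeal_iff _ hGe]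
  change contract (dehom G) (dehom F) = 0
  ext γ
  have h := coeff_zero_contract_dehom_eq_zero hF Q hfat hcancel hQ
    (Q.mul_mem_left (monomial (Finsupp.cons 0 γ) 1) hG)
    ((isHomogeneous_monomial (1 : k) (degree_cons 0 γ)).mul hGe)
  rw [← dehomHom_apply, map_mul, dehomHom_monomial, Finsupp.tail_cons, mul_contract,
    coeff_contract_monomial, one_mul, add_zero, dehomHom_apply] at h
  rw [h, coeff_zero]

end Homogenization

/-! ### Points, homogeneous primes and saturation -/

section Points

variable {k : Type*} [Field k] {n : ℕ}

theorem eval_eq_zero_of_mem_pointIdeal {L G : MvPolynomial (Fin (n + 1)) k}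
    (hG : G ∈ pointIdeal L) : eval (coeffVec L) G = 0 := by
  have h : pointIdeal L ≤ RingHom.ker (eval (coeffVec L)) := Ideal.span_le.2 fun H hH => hH.2
  exact h hG

theorem mem_pointIdeal_iff {L G : MvPolynomial (Fin (n + 1)) k} {e : ℕ} (hG : G.IsHomogeneous e) :
    G ∈ pointIdeal L ↔ eval (coeffVec L) G = 0 :=
  ⟨eval_eq_zero_of_mem_pointIdeal, fun h => Ideal.subset_span ⟨⟨e, hG⟩, h⟩⟩

theorem pointIdeal_isHomogeneous (L : MvPolynomial (Fin (n + 1)) k) :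
    (pointIdeal L).IsHomogeneous (homogeneousSubmodule (Fin (n + 1)) k) :=
  Ideal.homogeneous_span _ _ fun _ hG => hG.1

theorem isHomogeneous_pow {m : ℕ} {I : Ideal (MvPolynomial (Fin m) k)}
    (hI : I.IsHomogeneous (homogeneousSubmodule (Fin m) k)) (r : ℕ) :
    (I ^ r).IsHomogeneous (homogeneousSubmodule (Fin m) k) := by
  induction r with
  | zero => rw [pow_zero, Ideal.one_eq_top]; exact Ideal.IsHomogeneous.top _
  | succ r ih => rw [pow_succ]; exact ih.mul hI

theorem exists_coeffVec_ne_zero {L : MvPolynomial (Fin (n + 1)) k} (hL : L.IsHomogeneous 1)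
    (hL0 : L ≠ 0) : ∃ j, coeffVec L j ≠ 0 := by
  by_contra! h
  apply hL0
  rw [← linForm_coeffVec L hL]
  simp [linForm, h]

/-- A prime strictly above a point contains the irrelevant ideal. With `a_j ≠ 0`, the form `a_j^e G
- G(a) X_j^e` vanishes at `a`, so `X_j` lies in `P`; then `a_j X_i - a_i X_j` brings in every `X_i`.
-/
theorem X_mem_of_pointIdeal_le {L : MvPolynomial (Fin (n + 1)) k} (hL : L.IsHomogeneous 1)
    (hL0 : L ≠ 0) (P : Ideal (MvPolynomial (Fin (n + 1)) k)) [P.IsPrime] (hP : pointIdeal L ≤ P)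
    {G : MvPolynomial (Fin (n + 1)) k} {e : ℕ} (hGe : G.IsHomogeneous e) (hG : G ∈ P)
    (hGL : eval (coeffVec L) G ≠ 0) (i : Fin (n + 1)) : X i ∈ P := by
  obtain ⟨j, hj⟩ := exists_coeffVec_ne_zero hL hL0
  set a := coeffVec L with ha
  have hunit : ∀ (c : k), c ≠ 0 → ∀ H : MvPolynomial (Fin (n + 1)) k, C c * H ∈ P → H ∈ P := by
    intro c hc H hH
    have := P.mul_mem_left (C c⁻¹) hH
    rwa [← mul_assoc, ← C_mul, inv_mul_cancel₀ hc, C_1, one_mul] at this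
  have hXj : X j ∈ P := by
    have h1 : C (a j ^ e) * G - C (eval a G) * X j ^ e ∈ P := by
      apply hP
      rw [mem_pointIdeal_iff ((hGe.C_mul _).sub (isHomogeneous_C_mul_X_pow _ j e))]
      simp only [map_sub, map_mul, eval_C, map_pow, eval_X, ← ha]
      ring
    have h2 := P.sub_mem (P.mul_mem_left (C (a j ^ e)) hG) h1
    rw [sub_sub_cancel] at h2
    exact Ideal.IsPrime.mem_of_pow_mem ‹_› _ (hunit _ hGL _ h2)
  have h2 : C (a j) * X i - C (a i) * X j ∈ P := by
    apply hP
    rw [mem_pointIdeal_iff ((isHomogeneous_C_mul_X _ i).sub (isHomogeneous_C_mul_X _ j))]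
    simp only [map_sub, map_mul, eval_C, eval_X, ← ha]
    ring
  have h3 := P.add_mem h2 (P.mul_mem_left (C (a i)) hXj)
  rw [sub_add_cancel] at h3
  exact hunit _ hj _ h3

theorem eq_pointIdeal_of_le {L : MvPolynomial (Fin (n + 1)) k} (hL : L.IsHomogeneous 1)
    (hL0 : L ≠ 0) (P : Ideal (MvPolynomial (Fin (n + 1)) k)) [P.IsPrime]
    (hPh : P.IsHomogeneous (homogeneousSubmodule (Fin (n + 1)) k)) (hP : pointIdeal L ≤ P)
    (hX : ∃ i, X i ∉ P) : P = pointIdeal L := by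
  refine le_antisymm (fun G hG => ?_) hP
  refine mem_of_homogeneousComponent_mem _ _ fun e => ?_
  have h1 := homogeneousComponent_isHomogeneous e G
  rw [mem_pointIdeal_iff h1]
  by_contra h
  obtain ⟨i, hi⟩ := hX
  exact hi (X_mem_of_pointIdeal_le hL hL0 P hP h1 (homogeneousComponent_mem_of_mem hPh hG e) h i)

/-- The homogeneous core of `P` is again a prime containing `I`, so minimality makes it equal to
`P`. -/
theorem isHomogeneous_of_mem_minimalPrimes {m : ℕ} {I P : Ideal (MvPolynomial (Fin m) k)}
    (hI : I.IsHomogeneous (homogeneousSubmodule (Fin m) k)) (hP : P ∈ I.minimalPrimes) :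
    P.IsHomogeneous (homogeneousSubmodule (Fin m) k) := by
  have h1 : (P.homogeneousCore (homogeneousSubmodule (Fin m) k)).toIdeal.IsPrime :=
    hP.1.1.homogeneousCore
  have h2 : I ≤ (P.homogeneousCore (homogeneousSubmodule (Fin m) k)).toIdeal := by
    rw [← hI.toIdeal_homogeneousCore_eq_self]
    exact Ideal.homogeneousCore_mono _ hP.1.2
  have h3 := Ideal.toIdeal_homogeneousCore_le (homogeneousSubmodule (Fin m) k) P
  have h4 := le_antisymm h3 (hP.2 ⟨h1, h2⟩ h3)
  rw [← h4]
  exact HomogeneousIdeal.isHomogeneous _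

/-- The ideal of all `H` with `H * G ∈ I`. -/
def colonElem {m : ℕ} (I : Ideal (MvPolynomial (Fin m) k)) (G : MvPolynomial (Fin m) k) :
    Ideal (MvPolynomial (Fin m) k) :=
  Submodule.comap (LinearMap.toSpanSingleton (MvPolynomial (Fin m) k) (MvPolynomial (Fin m) k) G) I

theorem mem_colonElem {m : ℕ} (I : Ideal (MvPolynomial (Fin m) k)) (G H : MvPolynomial (Fin m) k) :
    H ∈ colonElem I G ↔ H * G ∈ I := Iff.rfl

theorem colonElem_isHomogeneous {m : ℕ} {I : Ideal (MvPolynomial (Fin m) k)}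
    (hI : I.IsHomogeneous (homogeneousSubmodule (Fin m) k)) {G : MvPolynomial (Fin m) k} {e : ℕ}
    (hG : G.IsHomogeneous e) :
    (colonElem I G).IsHomogeneous (homogeneousSubmodule (Fin m) k) := by
  refine isHomogeneous_of_homogeneousComponent_mem fun i H hH => ?_
  rw [mem_colonElem] at hH ⊢
  rw [← homogeneousComponent_mul_of_isHomogeneous i H hG]
  exact homogeneousComponent_mem_of_mem hI hH _

/-- Some power of the irrelevant ideal multiplies `G` into `I`, and saturation removes one factor at
a time. -/
theorem mem_of_X_mem_radical_colonElem {m : ℕ} {I : Ideal (MvPolynomial (Fin m) k)}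
    (hI : ∀ G, (∀ i, X i * G ∈ I) → G ∈ I) {G : MvPolynomial (Fin m) k}
    (hG : ∀ i, X i ∈ (colonElem I G).radical) : G ∈ I := by
  obtain ⟨N, hN⟩ := Ideal.exists_pow_le_of_le_radical_of_fg (I := idealOfVars (Fin m) k)
    (J := colonElem I G) (Ideal.span_le.2 (by rintro _ ⟨i, rfl⟩; exact hG i))
    (idealOfVars_fg (Fin m) k)
  clear hG
  induction N generalizing G with
  | zero =>
    have h1 : (1 : MvPolynomial (Fin m) k) ∈ colonElem I G := hN (by simp)
    rwa [mem_colonElem, one_mul] at h1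
  | succ N ih =>
    refine hI G fun i => ih fun H hH => ?_
    have := hN (by rw [pow_succ]; exact Ideal.mul_mem_mul hH (Ideal.subset_span ⟨i, rfl⟩))
    rwa [mem_colonElem, mul_assoc] at this

/-- Were all variables in `P`, every other minimal prime, being homogeneous and proper, would lie in
`P` and so equal it. The radical of `I` would then contain all variables, and saturation would give
`1 ∈ I`. -/
theorem exists_X_notMem_of_mem_minimalPrimes {m : ℕ} {I P : Ideal (MvPolynomial (Fin m) k)}
    (hIh : I.IsHomogeneous (homogeneousSubmodule (Fin m) k))
    (hI : ∀ G, (∀ i, X i * G ∈ I) → G ∈ I) (hP : P ∈ I.minimalPrimes) : ∃ i, X i ∉ P := by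
  by_contra! h
  have h1 : ∀ P' ∈ I.minimalPrimes, P' ≤ P := by
    intro P' hP' G hG
    have h2 := isHomogeneous_of_mem_minimalPrimes hIh hP'
    have h3 : coeff 0 G = 0 := by
      have h4 := homogeneousComponent_mem_of_mem h2 hG 0
      rw [homogeneousComponent_zero] at h4
      by_contra h5
      exact hP'.1.1.ne_top (Ideal.eq_top_of_isUnit_mem _ h4 ((isUnit_iff_ne_zero.2 h5).map C))
    have h6 : G ∈ idealOfVars (Fin m) k ^ 1 := by
      rw [mem_pow_idealOfVars_iff']
      intro α hα
      rw [(Finsupp.degree_eq_zero_iff α).1 (by omega), h3]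
    rw [pow_one] at h6
    exact Ideal.span_le.2 (by rintro _ ⟨i, rfl⟩; exact h i) h6
  have h2 : (1 : MvPolynomial (Fin m) k) ∈ I := by
    refine mem_of_X_mem_radical_colonElem hI fun i => ?_
    have h3 : colonElem I 1 = I := by
      ext H
      rw [mem_colonElem, mul_one]
    rw [h3, ← Ideal.sInf_minimalPrimes, Ideal.mem_sInf]
    intro P' hP'
    exact hP.2 hP'.1 (h1 P' hP') (h i)
  exact hP.1.1.ne_top ((Ideal.eq_top_iff_one P).2 (hP.1.2 h2))

/-- The ideal of all `G` that some homogeneous element outside `P` multiplies into `I`. -/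
def homogComponentIdeal {m : ℕ} (I P : Ideal (MvPolynomial (Fin m) k)) [hP : P.IsPrime] :
    Ideal (MvPolynomial (Fin m) k) where
  carrier := {G | ∃ H e, H.IsHomogeneous e ∧ H ∉ P ∧ H * G ∈ I}
  zero_mem' := ⟨1, 0, isHomogeneous_one _ _, (Ideal.ne_top_iff_one P).1 hP.ne_top, by simp⟩
  add_mem' := by
    rintro G G' ⟨H, e, h1, h2, h3⟩ ⟨H', e', h1', h2', h3'⟩
    refine ⟨H * H', e + e', h1.mul h1', hP.mul_notMem h2 h2', ?_⟩
    have : H * H' * (G + G') = H' * (H * G) + H * (H' * G') := by ring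
    rw [this]
    exact I.add_mem (I.mul_mem_left _ h3) (I.mul_mem_left _ h3')
  smul_mem' := by
    rintro c G ⟨H, e, h1, h2, h3⟩
    refine ⟨H, e, h1, h2, ?_⟩
    rw [smul_eq_mul, mul_left_comm]
    exact I.mul_mem_left _ h3

theorem homogComponentIdeal_isHomogeneous {m : ℕ} {I : Ideal (MvPolynomial (Fin m) k)}
    (hI : I.IsHomogeneous (homogeneousSubmodule (Fin m) k))
    (P : Ideal (MvPolynomial (Fin m) k)) [P.IsPrime] :
    (homogComponentIdeal I P).IsHomogeneous (homogeneousSubmodule (Fin m) k) := by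
  refine isHomogeneous_of_homogeneousComponent_mem ?_
  rintro i G ⟨H, e, h1, h2, h3⟩
  refine ⟨H, e, h1, h2, ?_⟩
  rw [mul_comm, ← homogeneousComponent_mul_of_isHomogeneous i G h1, mul_comm]
  exact homogeneousComponent_mem_of_mem hI h3 _

theorem le_homogComponentIdeal {m : ℕ} (I P : Ideal (MvPolynomial (Fin m) k)) [hP : P.IsPrime] :
    I ≤ homogComponentIdeal I P := fun G hG =>
  ⟨1, 0, isHomogeneous_one _ _, (Ideal.ne_top_iff_one P).1 hP.ne_top, by simpa using hG⟩

theorem mem_homogComponentIdeal_of_mul_mem {m : ℕ} {I P : Ideal (MvPolynomial (Fin m) k)}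
    [hP : P.IsPrime] {H G : MvPolynomial (Fin m) k} {e : ℕ} (hH : H.IsHomogeneous e) (hHP : H ∉ P)
    (h : H * G ∈ homogComponentIdeal I P) : G ∈ homogComponentIdeal I P := by
  obtain ⟨H', e', h1, h2, h3⟩ := h
  exact ⟨H' * H, e' + e, h1.mul hH, hP.mul_notMem h2 hHP, by rwa [mul_assoc]⟩

/-! ### Components at minimal primes -/

theorem mem_componentIdeal_iff (Z : ZeroDimScheme k n) (P : Ideal (MvPolynomial (Fin (n + 1)) k))
    [P.IsPrime] (G : MvPolynomial (Fin (n + 1)) k) :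
    G ∈ componentIdeal Z P ↔ ∃ H, H ∉ P ∧ H * G ∈ Z.ideal := by
  rw [componentIdeal, Ideal.mem_comap,
    IsLocalization.algebraMap_mem_map_algebraMap_iff P.primeCompl]
  rfl

/-- For a form `G` the colon ideal `(I : G)` is homogeneous, so a multiplier outside `P` has a
homogeneous component outside `P` that also works. -/
theorem le_homogComponentIdeal_of_le_componentIdeal {Z : ZeroDimScheme k n}
    {P K : Ideal (MvPolynomial (Fin (n + 1)) k)} [P.IsPrime]
    (hK : K.IsHomogeneous (homogeneousSubmodule (Fin (n + 1)) k))
    (h : K ≤ componentIdeal Z P) : K ≤ homogComponentIdeal Z.ideal P := by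
  intro G hG
  refine mem_of_homogeneousComponent_mem _ _ fun e => ?_
  have hGe := homogeneousComponent_isHomogeneous e G
  have hGK := homogeneousComponent_mem_of_mem hK hG e
  generalize homogeneousComponent e G = G' at hGe hGK
  obtain ⟨H, hHP, hH⟩ := (mem_componentIdeal_iff Z P G').1 (h hGK)
  by_contra hcon
  refine hHP (mem_of_homogeneousComponent_mem _ _ fun i => ?_)
  by_contra hi
  refine hcon ⟨homogeneousComponent i H, i, homogeneousComponent_isHomogeneous i H, hi, ?_⟩
  exact homogeneousComponent_mem_of_mem (colonElem_isHomogeneous Z.homogeneous hGe) hH i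

theorem componentIdeal_le (Z : ZeroDimScheme k n) (P : Ideal (MvPolynomial (Fin (n + 1)) k))
    [hP : P.IsPrime] (h : Z.ideal ≤ P) : componentIdeal Z P ≤ P := by
  intro G hG
  obtain ⟨H, hHP, hH⟩ := (mem_componentIdeal_iff Z P G).1 hG
  exact (hP.mem_or_mem (h hH)).resolve_left hHP

/-- A saturated homogeneous ideal whose minimal primes are ideals of points is the intersection of
its components. -/
theorem mem_of_forall_mem_homogComponentIdeal {I : Ideal (MvPolynomial (Fin (n + 1)) k)}
    (hIh : I.IsHomogeneous (homogeneousSubmodule (Fin (n + 1)) k))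
    (hI : ∀ G, (∀ i, X i * G ∈ I) → G ∈ I)
    (hpt : ∀ P ∈ I.minimalPrimes, ∃ L : MvPolynomial (Fin (n + 1)) k,
      L.IsHomogeneous 1 ∧ L ≠ 0 ∧ P = pointIdeal L)
    {G : MvPolynomial (Fin (n + 1)) k}
    (hG : ∀ (P : Ideal (MvPolynomial (Fin (n + 1)) k)) [P.IsPrime], P ∈ I.minimalPrimes →
      G ∈ homogComponentIdeal I P) : G ∈ I := by
  refine mem_of_homogeneousComponent_mem _ _ fun e => ?_
  have hGe := homogeneousComponent_isHomogeneous e G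
  have hG' : ∀ (P : Ideal (MvPolynomial (Fin (n + 1)) k)) [P.IsPrime], P ∈ I.minimalPrimes →
      homogeneousComponent e G ∈ homogComponentIdeal I P := fun P _ hP =>
    homogeneousComponent_mem_of_mem (homogComponentIdeal_isHomogeneous hIh P) (hG P hP) e
  generalize homogeneousComponent e G = H at hGe hG'
  -- A minimal prime `Q` of `(I : H)` lies over some point `P`, but also contains the form `K` that
  -- multiplies `H` into `I` and does not vanish there. Hence `Q` contains every variable.
  refine mem_of_X_mem_radical_colonElem hI fun i => ?_
  rw [← Ideal.sInf_minimalPrimes, Ideal.mem_sInf]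
  intro Q hQ
  have hQp : Q.IsPrime := hQ.1.1
  have hIQ : I ≤ Q := le_trans (fun K hK => I.mul_mem_right _ hK) hQ.1.2
  obtain ⟨P, hP, hPQ⟩ := Ideal.exists_minimalPrimes_le hIQ
  have hPp : P.IsPrime := hP.1.1
  obtain ⟨K, r, hK, hKP, hKH⟩ := hG' P hP
  obtain ⟨L, hL, hL0, rfl⟩ := hpt P hP
  refine X_mem_of_pointIdeal_le hL hL0 Q hPQ hK (hQ.1.2 hKH) ?_ i
  rwa [Ne, ← mem_pointIdeal_iff hK]

theorem exists_pointIdeal_pow_le_componentIdeal {Z : ZeroDimScheme k n} {r s : ℕ}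
    {L : Fin s → MvPolynomial (Fin (n + 1)) k} (hL : ∀ i, (L i).IsHomogeneous 1 ∧ L i ≠ 0)
    (h : ⨅ i, pointIdeal (L i) ^ r ≤ Z.ideal) (P : Ideal (MvPolynomial (Fin (n + 1)) k))
    [hPp : P.IsPrime] (hP : P ∈ Z.ideal.minimalPrimes) :
    ∃ i, pointIdeal (L i) ^ r ≤ componentIdeal Z P := by
  classical
  obtain ⟨j, hj⟩ := exists_X_notMem_of_mem_minimalPrimes Z.homogeneous Z.saturated hP
  obtain ⟨i₀, hi₀⟩ : ∃ i, pointIdeal (L i) ≤ P := by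
    have h1 : ∏ i, pointIdeal (L i) ^ r ≤ P :=
      (Ideal.prod_le_inf.trans (by rw [Finset.inf_univ_eq_iInf])).trans (h.trans hP.1.2)
    obtain ⟨i, _, hi⟩ := (Ideal.IsPrime.prod_le hPp).1 h1
    exact ⟨i, hPp.le_of_pow_le hi⟩
  refine ⟨i₀, fun G hG => (mem_componentIdeal_iff Z P G).2 ?_⟩
  -- Two distinct points below `P` would put every variable in `P`, contradicting `hj`.
  have h2 : ∀ i, pointIdeal (L i) ≤ P → pointIdeal (L i₀) ≤ pointIdeal (L i) := by
    intro i hi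
    refine Ideal.span_le.2 ?_
    rintro H ⟨⟨e, he⟩, h0⟩
    rw [SetLike.mem_coe, mem_pointIdeal_iff he]
    by_contra hne
    exact hj (X_mem_of_pointIdeal_le (hL i).1 (hL i).2 P hi he
      (hi₀ ((mem_pointIdeal_iff he).2 h0)) hne j)
  have h3 : ∀ i, ∃ H, H ∉ P ∧ H * G ∈ pointIdeal (L i) ^ r := by
    intro i
    by_cases hi : pointIdeal (L i) ≤ P
    · exact ⟨1, (Ideal.ne_top_iff_one P).1 hPp.ne_top, by
        rw [one_mul]; exact Ideal.pow_right_mono (h2 i hi) r hG⟩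
    · obtain ⟨H, hH, hHP⟩ := SetLike.not_le_iff_exists.1 hi
      exact ⟨H ^ r, fun hc => hHP (hPp.mem_of_pow_mem _ hc),
        Ideal.mul_mem_right _ _ (Ideal.pow_mem_pow hH r)⟩
  choose H hHP hH using h3
  refine ⟨∏ i, H i, fun hc => ?_, h ?_⟩
  · obtain ⟨i, _, hi⟩ := (Ideal.IsPrime.prod_mem_iff (hp := hPp)).1 hc
    exact hHP i hi
  · rw [Ideal.mem_iInf]
    intro i
    rw [← Finset.prod_erase_mul _ _ (Finset.mem_univ i), mul_assoc]
    exact Ideal.mul_mem_left _ _ (hH i)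

end Points

/-! ### Natural apolar schemes -/

section Natural

variable {k : Type*} [Field k] {n : ℕ}

theorem exists_naturalApolarIdeal_eq (F : MvPolynomial (Fin (n + 1)) k)
    {L : MvPolynomial (Fin (n + 1)) k} (hL : L.IsHomogeneous 1) (hL0 : L ≠ 0) :
    ∃ A : Matrix.GeneralLinearGroup (Fin (n + 1)) k, coeffVec L = A.1 0 ∧
      naturalApolarIdeal F L = naturalApolarIdealIn A F := by
  have h := exists_coords L hL hL0
  refine ⟨h.choose, ?_, ?_⟩
  · have h1 := congrArg coeffVec h.choose_spec
    rwa [coeffVec_linForm, eq_comm] at h1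
  · rw [naturalApolarIdeal, dif_pos h]

theorem naturalApolarIdeal_isHomogeneous (F : MvPolynomial (Fin (n + 1)) k)
    {L : MvPolynomial (Fin (n + 1)) k} (hL : L.IsHomogeneous 1) (hL0 : L ≠ 0) :
    (naturalApolarIdeal F L).IsHomogeneous (homogeneousSubmodule (Fin (n + 1)) k) := by
  obtain ⟨A, -, hA⟩ := exists_naturalApolarIdeal_eq F hL hL0
  rw [hA, naturalApolarIdealIn, homogIdeal, Ideal.map_span]
  refine Ideal.homogeneous_span _ _ ?_
  rintro _ ⟨_, ⟨g, -, rfl⟩, rfl⟩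
  exact ⟨_, dualCoords_isHomogeneous A (homog_isHomogeneous g)⟩

theorem naturalApolarIdeal_saturated (F : MvPolynomial (Fin (n + 1)) k)
    {L : MvPolynomial (Fin (n + 1)) k} (hL : L.IsHomogeneous 1) (hL0 : L ≠ 0)
    (G : MvPolynomial (Fin (n + 1)) k) (hG : ∀ i, X i * G ∈ naturalApolarIdeal F L) :
    G ∈ naturalApolarIdeal F L := by
  obtain ⟨A, -, hA⟩ := exists_naturalApolarIdeal_eq F hL hL0
  rw [hA, naturalApolarIdealIn] at hG ⊢
  have h : dualCoords A (X 0) * G ∈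
      (homogIdeal (contractAnn (dehom (toDP (changeCoords A F))))).map (dualCoords A) := by
    rw [dualCoords, aeval_X, linForm, Finset.sum_mul]
    refine Ideal.sum_mem _ fun i _ => ?_
    rw [mul_assoc]
    exact Ideal.mul_mem_left _ _ (hG i)
  rw [mem_map_dualCoords, map_mul, dualCoordsInv_dualCoords] at h
  rw [mem_map_dualCoords]
  exact homogIdeal_saturated _ _ h

theorem diffAct_eq_zero_of_mem_naturalApolarIdeal [CharZero k] {d : ℕ}
    {F : MvPolynomial (Fin (n + 1)) k} (hF : F.IsHomogeneous d)
    {L : MvPolynomial (Fin (n + 1)) k} (hL : L.IsHomogeneous 1) (hL0 : L ≠ 0)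
    {G : MvPolynomial (Fin (n + 1)) k} (hG : G ∈ naturalApolarIdeal F L) : diffAct G F = 0 := by
  obtain ⟨A, -, hA⟩ := exists_naturalApolarIdeal_eq F hL hL0
  rw [hA, naturalApolarIdealIn, mem_map_dualCoords] at hG
  have h := contract_eq_zero_of_mem_homogIdeal
    (toDP_isHomogeneous (changeCoords_isHomogeneous A hF)) hG
  rw [← diffAct_eq_zero_iff, ← changeCoords_diffAct, dualCoords_dualCoordsInv] at h
  refine changeCoords_injective A (h.trans ?_)
  exact (map_zero _).symm

/-- In coordinates adapted to `L`, evaluation at `L` is the constant term of the dehomogenization.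
So `℘_L` maps into the ideal of the origin, whose `(d + 1)`-st power annihilates polynomials of
degree at most `d`. -/
theorem pointIdeal_pow_le_naturalApolarIdeal {d : ℕ}
    {F : MvPolynomial (Fin (n + 1)) k} (hF : F.IsHomogeneous d)
    {L : MvPolynomial (Fin (n + 1)) k} (hL : L.IsHomogeneous 1) (hL0 : L ≠ 0) :
    pointIdeal L ^ (d + 1) ≤ naturalApolarIdeal F L := by
  obtain ⟨A, hA0, hA⟩ := exists_naturalApolarIdeal_eq F hL hL0
  rw [hA, naturalApolarIdealIn]
  have h1 : pointIdeal L ≤ (idealOfVars (Fin n) k).comap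
      ((dehomHom (k := k) (n := n)).comp (dualCoordsInv A)) := by
    refine Ideal.span_le.2 ?_
    rintro G ⟨-, hG⟩
    rw [hA0, ← eval_dualCoordsInv] at hG
    change dehomHom (dualCoordsInv A G) ∈ idealOfVars (Fin n) k
    rw [← pow_one (idealOfVars (Fin n) k), mem_pow_idealOfVars_iff']
    intro α hα
    rw [(Finsupp.degree_eq_zero_iff α).1 (by omega), ← hG]
    generalize dualCoordsInv A G = H
    induction H using MvPolynomial.induction_on with
    | C a => simp [dehomHom, algebraMap_eq]
    | add p q hp hq => simp only [map_add, coeff_add, hp, hq]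
    | mul_X p i hp =>
      rw [map_mul, map_mul, ← hp, eval_X]
      refine Fin.cases ?_ (fun i => ?_) i
      · simp [dehomHom]
      · simp [dehomHom, coeff_mul_X']
  intro G hG
  refine mem_of_homogeneousComponent_mem _ _ fun e => ?_
  have hGe := homogeneousComponent_isHomogeneous e G
  have hG' := homogeneousComponent_mem_of_mem
    (isHomogeneous_pow (pointIdeal_isHomogeneous L) (d + 1)) hG e
  generalize homogeneousComponent e G = H at hGe hG'
  rw [mem_map_dualCoords, mem_homogIdeal_iff _ (dualCoordsInv_isHomogeneous A hGe)]
  refine idealOfVars_pow_le_contractAnn (d := d) (totalDegree_dehom_le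
    (toDP_isHomogeneous (changeCoords_isHomogeneous A hF))) ?_
  exact Ideal.le_comap_pow _ _ (Ideal.pow_right_mono h1 (d + 1) hG')

/-- The coordinate-free form of `mem_homogIdeal_contractAnn`: the dual coordinates other than the
first vanish at `L`, which yields the monomials required in `Q`, while the first takes the value `1`
there and so can be cancelled by `hcancel`. -/
theorem le_naturalApolarIdeal [CharZero k] {d : ℕ}
    {F : MvPolynomial (Fin (n + 1)) k} (hF : F.IsHomogeneous d)
    {L : MvPolynomial (Fin (n + 1)) k} (hL : L.IsHomogeneous 1) (hL0 : L ≠ 0)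
    {Q : Ideal (MvPolynomial (Fin (n + 1)) k)}
    (hQh : Q.IsHomogeneous (homogeneousSubmodule (Fin (n + 1)) k))
    (hfat : pointIdeal L ^ (d + 1) ≤ Q)
    (hcancel : ∀ H e, H.IsHomogeneous e → H ∉ pointIdeal L → ∀ G, H * G ∈ Q → G ∈ Q)
    (hQ : ∀ G ∈ Q, G.IsHomogeneous d → coeff 0 (diffAct G F) = 0) :
    Q ≤ naturalApolarIdeal F L := by
  classical
  obtain ⟨A, hA0, hA⟩ := exists_naturalApolarIdeal_eq F hL hL0
  rw [hA, naturalApolarIdealIn]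
  intro G hG
  refine mem_of_homogeneousComponent_mem _ _ fun e => ?_
  have hGe := homogeneousComponent_isHomogeneous e G
  have hG' := homogeneousComponent_mem_of_mem hQh hG e
  generalize homogeneousComponent e G = H at hGe hG'
  rw [mem_map_dualCoords]
  refine mem_homogIdeal_contractAnn (d := d)
    (toDP_isHomogeneous (changeCoords_isHomogeneous A hF)) (Q.comap (dualCoords A)) ?_ ?_ ?_
    (G := dualCoordsInv A H) ?_ (dualCoordsInv_isHomogeneous A hGe)
  · intro a β c hβ
    have h1 : idealOfVars (Fin n) k ≤ (pointIdeal L).comap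
        ((dualCoords A).comp (rename (R := k) (Fin.succ (n := n)))) := by
      refine Ideal.span_le.2 ?_
      rintro _ ⟨i, rfl⟩
      change dualCoords A (rename Fin.succ (X i)) ∈ pointIdeal L
      rw [rename_X, mem_pointIdeal_iff (dualCoords_isHomogeneous A (isHomogeneous_X k _)), hA0,
        ← eval_dualCoordsInv, dualCoordsInv_dualCoords, eval_X]
      simp
    have h2 : monomial β c ∈ idealOfVars (Fin n) k ^ (d + 1) := by
      rw [mem_pow_idealOfVars_iff']
      intro α hα
      rw [coeff_monomial, if_neg]
      rintro rfl
      omega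
    have h3 := Ideal.le_comap_pow _ _ (Ideal.pow_right_mono h1 (d + 1) h2)
    have h4 : (monomial (Finsupp.cons a β) c : MvPolynomial (Fin (n + 1)) k) =
        X 0 ^ a * rename Fin.succ (monomial β c) := by
      rw [rename_monomial, X_pow_eq_monomial, monomial_mul, one_mul]
      congr 2
      ext i
      refine Fin.cases ?_ (fun i => ?_) i
      · rw [Finsupp.add_apply, Finsupp.mapDomain_of_notMem_range]
        · simp
        · rintro ⟨j, hj⟩
          exact Fin.succ_ne_zero j hj
      · rw [Finsupp.add_apply, Finsupp.mapDomain_apply (Fin.succ_injective n)]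
        simp
    rw [h4, Ideal.mem_comap, map_mul]
    exact Q.mul_mem_left _ (hfat h3)
  · intro K hK
    rw [Ideal.mem_comap, map_mul] at hK
    refine hcancel _ 1 (dualCoords_isHomogeneous A (isHomogeneous_X k 0)) ?_ _ hK
    rw [mem_pointIdeal_iff (dualCoords_isHomogeneous A (isHomogeneous_X k _)), hA0,
      ← eval_dualCoordsInv, dualCoordsInv_dualCoords, eval_X]
    simp
  · intro K hK hKd
    have h := hQ _ hK (dualCoords_isHomogeneous A hKd)
    rw [← coeff_zero_changeCoords A, changeCoords_diffAct] at h
    rw [← toDP_diffAct, coeff_toDP, h, mul_zero]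
  · rwa [Ideal.mem_comap, dualCoords_dualCoordsInv]

end Natural

/-! ### Decompositions -/

section Decomposition

variable {k : Type*} [Field k] [CharZero k] {n : ℕ}

omit [CharZero k] in
theorem coeff_zero_diffAct {m : ℕ} (G F : MvPolynomial (Fin m) k) :
    coeff 0 (diffAct G F) = ∑ β ∈ G.support, coeff β G * coeff β (toDP F) := by
  have h : coeff 0 (diffAct G F) = coeff 0 (toDP (diffAct G F)) := by simp [coeff_toDP]
  rw [h, toDP_diffAct, coeff_contract]
  simp

/-- A form apolar to an intersection of ideals is a sum of forms of the same degree,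
one orthogonal to each of the ideals. -/
theorem exists_sum_eq_of_iInf_apolar {m d : ℕ} {ι : Type*} [Fintype ι]
    {Q : ι → Ideal (MvPolynomial (Fin m) k)}
    {F : MvPolynomial (Fin m) k} (hF : F.IsHomogeneous d)
    (hap : ∀ G ∈ ⨅ i, Q i, diffAct G F = 0) :
    ∃ f : ι → MvPolynomial (Fin m) k, (∀ i, (f i).IsHomogeneous d) ∧ F = ∑ i, f i ∧
      ∀ i, ∀ G ∈ Q i, G.IsHomogeneous d → coeff 0 (diffAct G (f i)) = 0 := by
  classical
  -- Pairing with `F` annihilates the intersection of the `Q i`. The annihilator of a finite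
  -- intersection of subspaces is the sum of their annihilators, so this functional splits.
  let φ : Module.Dual k (MvPolynomial (Fin m) k) :=
    { toFun := fun G => coeff 0 (diffAct G F)
      map_add' := fun G H => by rw [diffAct_add_left, coeff_add]
      map_smul' := fun c G => by
        rw [smul_eq_C_mul, diffAct_mul, diffAct_C, coeff_C_mul]; rfl }
  have hφ : φ ∈ (⨅ i, (Q i).restrictScalars k).dualAnnihilator := by
    rw [Submodule.mem_dualAnnihilator]
    intro G hG
    change coeff 0 (diffAct G F) = 0
    rw [hap G, coeff_zero]
    simpa [Submodule.mem_iInf] using hG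
  rw [Subspace.dualAnnihilator_iInf_eq, Submodule.mem_iSup_iff_exists_finsupp] at hφ
  obtain ⟨ψ, hψ, hsum⟩ := hφ
  have hsum' : ∑ i, ψ i = φ := by
    rw [← hsum, Finsupp.sum_fintype _ _ (by simp)]
  have hfin : {α : Fin m →₀ ℕ | α.degree = d}.Finite := Finsupp.finite_of_degree_eq d
  -- The form of degree `d` representing `ψ i` in degree `d`; dividing by `α!` compensates the
  -- factor in `toDP`. The values of `ψ i` in other degrees are discarded.
  let f : ι → MvPolynomial (Fin m) k := fun i => ∑ α ∈ hfin.toFinset,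
    monomial α (((∏ j, (α j).factorial : ℕ) : k)⁻¹ * ψ i (monomial α 1))
  have hfac : ∀ α : Fin m →₀ ℕ, ((∏ j, (α j).factorial : ℕ) : k) ≠ 0 := fun α =>
    Nat.cast_ne_zero.2 (Finset.prod_ne_zero_iff.2 fun i _ => Nat.factorial_ne_zero _)
  have hcoeff : ∀ i α, α.degree = d → coeff α (toDP (f i)) = ψ i (monomial α 1) := by
    intro i α hα
    simp only [f, coeff_toDP, coeff_sum, coeff_monomial]
    rw [Finset.sum_ite_eq', if_pos (by simpa using hα), mul_inv_cancel_left₀ (hfac α)]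
  have hfd : ∀ i, (f i).IsHomogeneous d := fun i =>
    IsHomogeneous.sum _ _ _ fun α hα => isHomogeneous_monomial _ (by simpa using hα)
  refine ⟨f, hfd, ?_, ?_⟩
  · ext α
    by_cases hα : α.degree = d
    · refine mul_left_cancel₀ (hfac α) ?_
      rw [coeff_sum, Finset.mul_sum, ← coeff_toDP]
      simp only [← coeff_toDP, hcoeff _ α hα]
      rw [← LinearMap.sum_apply, hsum']
      change _ = coeff 0 (diffAct (monomial α 1) F)
      rw [coeff_zero_diffAct, support_monomial, if_neg one_ne_zero, Finset.sum_singleton,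
        coeff_monomial, if_pos rfl, one_mul]
    · rw [hF.coeff_eq_zero hα, (IsHomogeneous.sum _ _ _ fun i _ => hfd i).coeff_eq_zero hα]
  · intro i G hG hGd
    have h1 : ψ i G = 0 := (Submodule.mem_dualAnnihilator _).1 (hψ i) G hG
    rw [coeff_zero_diffAct, ← h1]
    conv_rhs => rw [← support_sum_monomial_coeff G, map_sum]
    refine Finset.sum_congr rfl fun β hβ => ?_
    have h2 : β.degree = d := by
      by_contra h
      exact mem_support_iff.1 hβ (hGd.coeff_eq_zero h)
    have h3 : monomial β (coeff β G) = coeff β G • (monomial β 1 : MvPolynomial (Fin m) k) := by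
      rw [smul_monomial, smul_eq_mul, mul_one]
    rw [hcoeff i β h2, h3, map_smul, smul_eq_mul]

omit [CharZero k] in
theorem exists_eq_pow_mul {d : ℕ} {F L : MvPolynomial (Fin (n + 1)) k} (hF : F.IsHomogeneous d)
    (hF0 : F ≠ 0) (hL : L.IsHomogeneous 1) (hL0 : L ≠ 0) :
    ∃ e G, e ≤ d ∧ G.IsHomogeneous e ∧ ¬ L ∣ G ∧ F = L ^ (d - e) * G := by
  have hunit : ¬ IsUnit L := by
    intro h
    obtain ⟨j, hj⟩ := exists_coeffVec_ne_zero hL hL0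
    have h1 := h.map (constantCoeff (R := k) (σ := Fin (n + 1)))
    rw [constantCoeff_eq, hL.coeff_eq_zero (by simp)] at h1
    exact not_isUnit_zero h1
  have hfin : FiniteMultiplicity L F := FiniteMultiplicity.of_not_isUnit hunit hF0
  obtain ⟨G, hG, hGL⟩ := hfin.exists_eq_pow_mul_and_not_dvd
  set r := multiplicity L F
  have hG0 : G ≠ 0 := by
    rintro rfl
    exact hGL (dvd_zero L)
  have hr : r ≤ d := by
    have h1 := totalDegree_mul_of_isDomain (pow_ne_zero r hL0) hG0
    rw [← hG, hF.totalDegree hF0, (hL.pow r).totalDegree (pow_ne_zero r hL0), one_mul] at h1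
    omega
  refine ⟨d - r, G, Nat.sub_le _ _, ?_, hGL, ?_⟩
  -- The cofactor is homogeneous: take the component of degree `d` in `F = L ^ r * G` and cancel `L
  -- ^ r`.
  · have h1 : homogeneousComponent (d - r) G = G := by
      refine mul_right_cancel₀ (pow_ne_zero r hL0) ?_
      have h2 := hL.pow r
      rw [one_mul] at h2
      rw [← homogeneousComponent_mul_of_isHomogeneous _ _ h2, Nat.sub_add_cancel hr, mul_comm G,
        ← hG, homogeneousComponent_eq_self hF]
    rw [← h1]
    exact homogeneousComponent_isHomogeneous _ _
  · rwa [Nat.sub_sub_self hr]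

omit [CharZero k] in
theorem exists_GAD {d : ℕ} {F : MvPolynomial (Fin (n + 1)) k} {ι : Type*} [Fintype ι]
    {f L : ι → MvPolynomial (Fin (n + 1)) k} (hf : ∀ i, (f i).IsHomogeneous d)
    (hf0 : ∀ i, f i ≠ 0) (hL : ∀ i, (L i).IsHomogeneous 1) (hL0 : ∀ i, L i ≠ 0)
    (hprop : ∀ i j, i ≠ j → ∀ c : k, L i ≠ c • L j) (hF : F = ∑ i, f i) :
    ∃ D : GAD d F, ∀ Z : ZeroDimScheme k n,
      IsEvincedBy Z D ↔ Z.ideal = ⨅ i, naturalApolarIdeal (f i) (L i) := by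
  choose e G he hG hGL hfG using fun i => exists_eq_pow_mul (hf i) (hf0 i) (hL i) (hL0 i)
  let σ := (Fintype.equivFin ι).symm
  refine ⟨⟨Fintype.card ι, fun i => L (σ i), fun i => e (σ i), fun i => G (σ i),
    fun i => hL _, fun i => hL0 _, fun i j hij => hprop _ _ (σ.injective.ne hij), fun i => he _,
    fun i => hG _, fun i => hGL _, ?_⟩, fun Z => ?_⟩
  · simp only [← hfG]
    rw [hF, ← σ.sum_comp]
  · simp only [IsEvincedBy, ← hfG]
    rw [σ.iInf_comp (g := fun i => naturalApolarIdeal (f i) (L i))]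

omit [CharZero k] in
theorem eval_smul_of_isHomogeneous {m e : ℕ} {G : MvPolynomial (Fin m) k} (hG : G.IsHomogeneous e)
    (c : k) (a : Fin m → k) : eval (c • a) G = c ^ e * eval a G := by
  rw [eval_eq', eval_eq', Finset.mul_sum]
  refine Finset.sum_congr rfl fun α hα => ?_
  have h : α.degree = e := by
    by_contra h
    exact mem_support_iff.1 hα (hG.coeff_eq_zero h)
  simp only [Pi.smul_apply, smul_eq_mul, mul_pow, Finset.prod_mul_distrib, Finset.prod_pow_eq_pow_sum]
  rw [← Finsupp.degree_eq_sum, h]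
  ring

theorem exists_evincing_GAD {d : ℕ} {F : MvPolynomial (Fin (n + 1)) k} (hF : F.IsHomogeneous d)
    {Z : ZeroDimScheme k n} (hZ : IsIrredundant Z F)
    (hcomp : ∀ (P : Ideal (MvPolynomial (Fin (n + 1)) k)) [P.IsPrime], P ∈ Z.ideal.minimalPrimes →
      ∃ L : MvPolynomial (Fin (n + 1)) k, L.IsHomogeneous 1 ∧ L ≠ 0 ∧
        pointIdeal L ^ (d + 1) ≤ componentIdeal Z P) :
    ∃ D : GAD d F, IsEvincedBy Z D := by
  classical
  have hprime : ∀ P : Z.ideal.minimalPrimes, P.1.IsPrime := fun P => P.2.1.1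
  choose L hL hL0 hfat using fun P : Z.ideal.minimalPrimes => @hcomp P.1 (hprime P) P.2
  have hPL : ∀ P : Z.ideal.minimalPrimes, P.1 = pointIdeal (L P) := fun P => by
    have := hprime P
    refine eq_pointIdeal_of_le (hL P) (hL0 P) P.1
      (isHomogeneous_of_mem_minimalPrimes Z.homogeneous P.2) ?_
      (exists_X_notMem_of_mem_minimalPrimes Z.homogeneous Z.saturated P.2)
    exact (hprime P).le_of_pow_le ((hfat P).trans (componentIdeal_le Z P.1 P.2.1.2))
  have : Finite Z.ideal.minimalPrimes :=
    Ideal.finite_minimalPrimes_of_isNoetherianRing _ Z.ideal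
  have : Fintype Z.ideal.minimalPrimes := Fintype.ofFinite _
  let Q : Z.ideal.minimalPrimes → Ideal (MvPolynomial (Fin (n + 1)) k) := fun P =>
    @homogComponentIdeal _ _ _ Z.ideal P.1 (hprime P)
  have hQh : ∀ P, (Q P).IsHomogeneous (homogeneousSubmodule (Fin (n + 1)) k) := fun P =>
    @homogComponentIdeal_isHomogeneous _ _ _ _ Z.homogeneous P.1 (hprime P)
  have hQI : ∀ G ∈ ⨅ P, Q P, G ∈ Z.ideal := by
    intro G hG
    refine mem_of_forall_mem_homogComponentIdeal Z.homogeneous Z.saturated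
      (fun P hP => ⟨L ⟨P, hP⟩, hL _, hL0 _, hPL ⟨P, hP⟩⟩) fun P _ hP => ?_
    exact (Ideal.mem_iInf.1 hG) ⟨P, hP⟩
  obtain ⟨f, hf, hFf, hQf⟩ := exists_sum_eq_of_iInf_apolar hF fun G hG => hZ.1 G (hQI G hG)
  -- A zero summand cannot occur in a decomposition, since every `L` divides `0`. Dropping its point
  -- leaves a scheme still contained in `Z`.
  let ι := {P : Z.ideal.minimalPrimes // f P ≠ 0}
  have hFι : F = ∑ i : ι, f i.1 := by
    rw [hFf, ← Finset.sum_filter_ne_zero]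
    exact Finset.sum_subtype _ (by simp) f
  have hprop : ∀ i j : ι, i ≠ j → ∀ c : k, L i.1 ≠ c • L j.1 := by
    intro i j hij c hc
    apply hij
    have hc0 : c ≠ 0 := by
      rintro rfl
      exact hL0 i.1 (by rw [hc, zero_smul])
    -- One inclusion is enough, because both ideals are minimal primes of `Z.ideal`.
    have h1 : pointIdeal (L i.1) ≤ pointIdeal (L j.1) := by
      refine Ideal.span_le.2 ?_
      rintro G ⟨⟨e, he⟩, h0⟩
      rw [SetLike.mem_coe, mem_pointIdeal_iff he]
      have h2 : coeffVec (L i.1) = c • coeffVec (L j.1) := by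
        rw [hc]
        funext l
        simp [coeffVec]
      rw [h2, eval_smul_of_isHomogeneous he] at h0
      exact (mul_eq_zero.1 h0).resolve_left (pow_ne_zero _ hc0)
    rw [← hPL, ← hPL] at h1
    exact Subtype.ext (Subtype.ext (le_antisymm h1 (j.1.2.2 i.1.2.1 h1)))
  obtain ⟨D, hD⟩ := exists_GAD (fun i : ι => hf i.1) (fun i => i.2) (fun i => hL i.1)
    (fun i => hL0 i.1) hprop hFι
  refine ⟨D, (hD Z).2 ?_⟩
  have hle : Z.ideal ≤ ⨅ i : ι, naturalApolarIdeal (f i.1) (L i.1) := by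
    refine le_iInf fun i => ?_
    have := hprime i.1
    refine (le_homogComponentIdeal Z.ideal i.1.1).trans ?_
    refine le_naturalApolarIdeal (hf i.1) (hL i.1) (hL0 i.1) (hQh i.1) ?_ ?_ (hQf i.1)
    · exact le_homogComponentIdeal_of_le_componentIdeal
        (isHomogeneous_pow (pointIdeal_isHomogeneous _) _) (hfat i.1)
    · intro H e hH hHP G hG
      rw [← hPL] at hHP
      exact mem_homogComponentIdeal_of_mul_mem hH hHP hG
  let Z' : ZeroDimScheme k n :=
    { ideal := ⨅ i : ι, naturalApolarIdeal (f i.1) (L i.1)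
      homogeneous := Ideal.IsHomogeneous.iInf fun i =>
        naturalApolarIdeal_isHomogeneous _ (hL i.1) (hL0 i.1)
      saturated := fun G hG => by
        rw [Ideal.mem_iInf]
        exact fun i => naturalApolarIdeal_saturated _ (hL i.1) (hL0 i.1) G fun j =>
          Ideal.mem_iInf.1 (hG j) i
      dim_le := le_trans (ringKrullDim_le_of_surjective (Ideal.Quotient.factor hle)
        (Ideal.Quotient.factor_surjective hle)) Z.dim_le }
  -- `Z'` lies in `Z` by `hle` and is apolar to each summand, hence to `F`; irredundancy of `Z`
  -- gives equality.
  have hZ' : Z' = Z := by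
    refine hZ.2 Z' hle fun G hG => ?_
    rw [hFι, diffAct_sum_right]
    exact Finset.sum_eq_zero fun i _ => diffAct_eq_zero_of_mem_naturalApolarIdeal (hf i.1)
      (hL i.1) (hL0 i.1) (Ideal.mem_iInf.1 hG i)
  exact (congrArg ZeroDimScheme.ideal hZ').symm

end Decomposition

end Apolarity

end

/-! ### The cycle of implications -/

theorem mainTheorem3 {k : Type*} [Field k] [IsAlgClosed k] [CharZero k] (n d : ℕ)
    (F : MvPolynomial (Fin (n + 1)) k) (hF : F.IsHomogeneous d)
    (Z : Apolarity.ZeroDimScheme k n) (hZ : Apolarity.IsIrredundant Z F) :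
    ((∃ D : Apolarity.GAD d F, Apolarity.IsEvincedBy Z D) ↔
      ∃ (s : ℕ) (L : Fin s → MvPolynomial (Fin (n + 1)) k),
        (∀ i, (L i).IsHomogeneous 1 ∧ L i ≠ 0) ∧
          ⨅ i, Apolarity.pointIdeal (L i) ^ (d + 1) ≤ Z.ideal) ∧
    ((∃ D : Apolarity.GAD d F, Apolarity.IsEvincedBy Z D) ↔
      ∀ (P : Ideal (MvPolynomial (Fin (n + 1)) k)) [P.IsPrime], P ∈ Z.ideal.minimalPrimes →
        ∃ L : MvPolynomial (Fin (n + 1)) k, L.IsHomogeneous 1 ∧ L ≠ 0 ∧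
          Apolarity.pointIdeal L ^ (d + 1) ≤ Apolarity.componentIdeal Z P) := by
  have h12 : (∃ D : Apolarity.GAD d F, Apolarity.IsEvincedBy Z D) →
      ∃ (s : ℕ) (L : Fin s → MvPolynomial (Fin (n + 1)) k),
        (∀ i, (L i).IsHomogeneous 1 ∧ L i ≠ 0) ∧
          ⨅ i, Apolarity.pointIdeal (L i) ^ (d + 1) ≤ Z.ideal := by
    rintro ⟨D, hD⟩
    refine ⟨D.s, D.L, fun i => ⟨D.L_homogeneous i, D.L_ne_zero i⟩, ?_⟩
    rw [hD]
    refine iInf_mono fun i => Apolarity.pointIdeal_pow_le_naturalApolarIdeal ?_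
      (D.L_homogeneous i) (D.L_ne_zero i)
    have h := ((D.L_homogeneous i).pow (d - D.deg i)).mul (D.G_homogeneous i)
    rwa [one_mul, Nat.sub_add_cancel (D.deg_le i)] at h
  have h23 : (∃ (s : ℕ) (L : Fin s → MvPolynomial (Fin (n + 1)) k),
        (∀ i, (L i).IsHomogeneous 1 ∧ L i ≠ 0) ∧
          ⨅ i, Apolarity.pointIdeal (L i) ^ (d + 1) ≤ Z.ideal) →
      ∀ (P : Ideal (MvPolynomial (Fin (n + 1)) k)) [P.IsPrime], P ∈ Z.ideal.minimalPrimes →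
        ∃ L : MvPolynomial (Fin (n + 1)) k, L.IsHomogeneous 1 ∧ L ≠ 0 ∧
          Apolarity.pointIdeal L ^ (d + 1) ≤ Apolarity.componentIdeal Z P := by
    rintro ⟨s, L, hL, h⟩ P _ hP
    obtain ⟨i, hi⟩ := Apolarity.exists_pointIdeal_pow_le_componentIdeal hL h P hP
    exact ⟨L i, (hL i).1, (hL i).2, hi⟩
  have h31 := Apolarity.exists_evincing_GAD hF hZ
  exact ⟨⟨h12, fun h => h31 (h23 h)⟩, ⟨fun h => h23 (h12 h), h31⟩⟩
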